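/- Notation. Let $\hat{\mathbb Q}=\mathbb Q\cup\{\infty\}$. Let $\Gamma_r$ be the group generated by the reflections of the hyperbolic plane in the edges of the Farey tessellation with an endpoint $r\in\hat{\mathbb Q}$, and let $\hat\Gamma_r$ be the group generated by $\Gamma_r$ and $\Gamma_\infty$; these groups act on the set $\hat{\mathbb Q}$ of ideal vertices of the tessellation. Let $H$ be the group generated by the $\pi$-rotations of $\mathbb R^2$ about the points of $\mathbb Z^2$. The Conway sphere is $\mathbb R^2/H$ with its four marked points $\mathbb Z^2/H$. For $s\in\hat{\mathbb Q}$, $\alpha_s$ is the unoriented simple loop in $(\mathbb R^2-\mathbb Z^2)/H$ that is the projection of a line of slope $s$ in $\mathbb R^2-\mathbb Z^2$. The 2-bridge link $(S^3,K(r))$ is obtained from the rational tangles of slopes $\infty$ and $r$, whose boundaries are marked by the Conway sphere, by identifying the boundaries through the identity; here the rational tangle of slope $r$ is the trivial tangle in which $\alpha_r$ bounds a disk that separates the two strands. Write $[m_1,\dots,m_k]=1/(m_1+1/(m_2+\cdots+1/m_k))$, and let the empty continued fraction be $0$. Lemma 7.1. Let $r$ be a rational number with $0<r<1$, and write $r=[m_1,\dots,m_k]$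 with $k\ge 1$, all $m_i$ positive integers, and $m_k\ge 2$. Let $I_1=[0,r_1]$ and $I_2=[r_2,1]$, where $$(r_1,r_2)=\begin{cases}([m_1,\dots,m_{k-1}],\ [m_1,\dots,m_{k-1},m_k-1]) & \text{if } k \text{ is odd},\\ ([m_1,\dots,m_{k-1},m_k-1],\ [m_1,\dots,m_{k-1}]) & \text{if } k \text{ is even}.\end{cases}$$ Then for every $s\in\hat{\mathbb Q}$ there is a unique $s_0\in\hat{\mathbb Q}$ with $s_0\in I_1\cup I_2\cup\{\infty,r\}$ such that $s$ lies in the $\hat\Gamma_r$-orbit of $s_0$. Moreover, for this $s_0$, the unoriented loops $\alpha_s$ and $\alpha_{s_0}$ are (freely) homotopic in $S^3-K(r)$. -/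

import Mathlib

open scoped OnePoint unitInterval

noncomputable section

namespace TwoBridge

/-! ### Slopes and the Farey tessellation -/

/-- `ℚ ∪ {∞}`: slopes, and also the ideal vertices of the Farey tessellation. -/
abbrev Slope : Type := OnePoint ℚ

/-- The primitive integer vector `(p, q)` of slope `q / p`, with `p > 0`; it is `(0, 1)` for
the slope `∞ = 1 / 0`. -/
def slopeVec (s : Slope) : ℤ × ℤ :=
  OnePoint.elim s (0, 1) fun q : ℚ => ((q.den : ℤ), q.num)

/-- `x = q / p` and `y = q' / p'` are the ends of an edge of the Farey tessellation:
`|p q' - q p'| = 1`. -/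
def IsFareyEdge (x y : Slope) : Prop :=
  |(slopeVec x).1 * (slopeVec y).2 - (slopeVec x).2 * (slopeVec y).1| = 1

/-- A matrix `g` represents the reflection of the hyperbolic plane in the geodesic with the
distinct ideal endpoints `x` and `y`: it is the involutive orientation-reversing isometry
(determinant `-1`) that fixes both ideal endpoints. Exactly two matrices, `g` and `-g`, satisfy
this, and they represent the same isometry. The action of `GL (Fin 2) ℚ` on `OnePoint ℚ` is by
fractional linear transformations. -/
def IsReflection (g : GL (Fin 2) ℚ) (x y : Slope) : Prop :=
  (g : Matrix (Fin 2) (Fin 2) ℚ).det = -1 ∧ g * g = 1 ∧ g • x = x ∧ g • y = y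

/-- `Γ_r`: the group generated by the reflections in the Farey edges with an endpoint `r`
(as a group of matrices; the passage to isometries divides out `± 1`, which acts trivially). -/
def Gam (r : Slope) : Subgroup (GL (Fin 2) ℚ) :=
  Subgroup.closure {g | ∃ y : Slope, IsFareyEdge r y ∧ IsReflection g r y}

/-- `Γ̂_r`: the group generated by `Γ_r` and `Γ_∞`. -/
def GamHat (r : Slope) : Subgroup (GL (Fin 2) ℚ) :=
  Gam r ⊔ Gam ∞

/-! ### Continued fractions and the intervals `I₁`, `I₂` -/

/-- `[m₁, …, m_k] = 1 / (m₁ + 1 / (m₂ + ⋯ + 1 / m_k))`; the empty one is `0`. -/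
def contFrac : List ℕ → ℚ
  | [] => 0
  | m :: l => 1 / ((m : ℚ) + contFrac l)

theorem contFrac_nonneg (l : List ℕ) : 0 ≤ contFrac l := by
  induction l with
  | nil => simp [contFrac]
  | cons m l ih => simp only [contFrac]; positivity

/-- Every rational number strictly between `0` and `1` is `[m₁, …, m_k]` with `k ≥ 1`, all
`m_i ≥ 1` and `m_k ≥ 2`. -/
theorem exists_contFrac (r : ℚ) (h0 : 0 < r) (h1 : r < 1) :
    ∃ (l : List ℕ) (n : ℕ), (∀ m ∈ l, 1 ≤ m) ∧ 2 ≤ n ∧ r = contFrac (l ++ [n]) := by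
  induction hd : r.num.toNat using Nat.strong_induction_on generalizing r with
  | _ d ih =>
    have hn : 0 < r.num := Rat.num_pos.2 h0
    have hr : r * r.den = r.num := Rat.mul_den_eq_num r
    have hdp : (0 : ℚ) < r.den := by exact_mod_cast r.den_pos
    obtain ⟨a, ha⟩ := Int.eq_ofNat_of_zero_le hn.le
    have ha0 : 0 < a := by omega
    have ha0' : (0 : ℚ) < a := by exact_mod_cast ha0
    rw [ha] at hr
    have hr : r * r.den = a := by exact_mod_cast hr
    have hlt : a < r.den := by
      have : (a : ℚ) < r.den := by nlinarith
      exact_mod_cast this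
    have hrinv : r = 1 / ((r.den : ℚ) / a) := by field_simp; linarith
    set m := r.den / a with hm
    have hm1 : 1 ≤ m := (Nat.one_le_div_iff ha0).2 hlt.le
    have hdm : (r.den : ℚ) = a * m + (r.den % a : ℕ) := by
      exact_mod_cast (Nat.div_add_mod r.den a).symm
    by_cases hz : r.den % a = 0
    · refine ⟨[], m, by simp, ?_, ?_⟩
      · have h2 : r.den = a * m := (Nat.mul_div_cancel' (Nat.dvd_of_mod_eq_zero hz)).symm
        by_contra hc
        have h3 : m = 1 := by omega
        rw [h3, mul_one] at h2
        omega
      · rw [hz] at hdm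
        rw [hrinv, hdm]
        simp [contFrac]
        field_simp
    · have hmod : r.den % a < a := Nat.mod_lt _ ha0
      have hpos : (0 : ℚ) < (r.den % a : ℕ) := by exact_mod_cast Nat.pos_of_ne_zero hz
      have hmod' : ((r.den % a : ℕ) : ℚ) < a := by exact_mod_cast hmod
      set t : ℚ := ((r.den % a : ℕ) : ℚ) / a with ht
      have ht0 : 0 < t := by positivity
      have ht1 : t < 1 := by rw [ht, div_lt_one ha0']; exact hmod'
      have hnum : t.num.toNat < d := by
        have hdvd : t.num ∣ ((r.den % a : ℕ) : ℤ) := by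
          have := Rat.num_dvd ((r.den % a : ℕ) : ℤ) (b := (a : ℤ)) (by omega)
          rwa [Rat.divInt_eq_div, Int.cast_natCast, Int.cast_natCast] at this
        have := Int.le_of_dvd (by omega) hdvd
        omega
      obtain ⟨l, n, hl, hn2, he⟩ := ih _ hnum t ht0 ht1 rfl
      refine ⟨m :: l, n, by simpa using ⟨hm1, hl⟩, hn2, ?_⟩
      rw [List.cons_append, contFrac, ← he, hrinv, hdm, ht]
      congr 1
      field_simp

/-- The right end `r₁` of `I₁ = [0, r₁]` for `r = [m₁, …, m_k]`, where `l = (m₁, …, m_{k-1})`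
and `n = m_k`. Thus `k = l.length + 1` is odd if and only if `l.length` is even. -/
def rOne (l : List ℕ) (n : ℕ) : ℚ :=
  if Even l.length then contFrac l else contFrac (l ++ [n - 1])

/-- The left end `r₂` of `I₂ = [r₂, 1]`, with the same conventions. -/
def rTwo (l : List ℕ) (n : ℕ) : ℚ :=
  if Even l.length then contFrac (l ++ [n - 1]) else contFrac l

/-- The elements of `ℚ ∪ {∞}` in `I₁ ∪ I₂ ∪ {∞, r}`, where `r = [m₁, …, m_k]`,
`l = (m₁, …, m_{k-1})` and `n = m_k`. -/
def fundSet (l : List ℕ) (n : ℕ) : Set Slope :=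
  (fun q : ℚ => (q : Slope)) '' (Set.Icc 0 (rOne l n) ∪ Set.Icc (rTwo l n) 1) ∪
    {∞, ((contFrac (l ++ [n]) : ℚ) : Slope)}

/-! ### The Conway sphere -/

/-- The point of the plane with the given integer coordinates. -/
def latticePoint (w : ℤ × ℤ) : ℝ × ℝ := ((w.1 : ℝ), (w.2 : ℝ))

/-- The lattice `ℤ²` in the plane. -/
def lattice : Set (ℝ × ℝ) := Set.range latticePoint

/-- The group `H` generated by the rotations by `π`, `v ↦ 2 w - v`, about the points `w` of
`ℤ²`. -/
def conwayGroup : Subgroup (Equiv.Perm (ℝ × ℝ)) :=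
  Subgroup.closure (Set.range fun w : ℤ × ℤ => Equiv.pointReflection (latticePoint w))

/-- The Conway sphere `ℝ² / H`, with the quotient topology. -/
def ConwaySphere : Type := Quotient (MulAction.orbitRel conwayGroup (ℝ × ℝ))

instance : TopologicalSpace ConwaySphere :=
  inferInstanceAs (TopologicalSpace (Quotient (MulAction.orbitRel conwayGroup (ℝ × ℝ))))

/-- The projection from the plane to the Conway sphere. -/
def proj (v : ℝ × ℝ) : ConwaySphere :=
  Quotient.mk (MulAction.orbitRel conwayGroup (ℝ × ℝ)) v

/-- The four marked points `P = ℤ² / H` of the Conway sphere. -/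
def punctures : Set ConwaySphere := proj '' lattice

/-- The direction vector `(p, q)` of the lines of slope `q / p`. -/
def dir (s : Slope) : ℝ × ℝ := latticePoint (slopeVec s)

/-- Two points of the Conway sphere lie on the projection of one line of slope `s`. -/
def SameLeaf (s : Slope) (x y : ConwaySphere) : Prop :=
  ∃ (v : ℝ × ℝ) (t : ℝ), proj v = x ∧ proj (v + t • dir s) = y

theorem continuous_proj : Continuous proj := continuous_quotient_mk'

theorem proj_add_two_mul (v : ℝ × ℝ) (w : ℤ × ℤ) :
    proj (v + (2 : ℝ) • latticePoint w) = proj v := by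
  refine Quotient.sound (s := MulAction.orbitRel conwayGroup (ℝ × ℝ)) ?_
  refine ⟨⟨Equiv.pointReflection (latticePoint w) * Equiv.pointReflection (latticePoint 0),
    mul_mem (Subgroup.subset_closure ⟨w, rfl⟩) (Subgroup.subset_closure ⟨0, rfl⟩)⟩, ?_⟩
  ext <;> simp [Subgroup.smul_def, Equiv.pointReflection_apply, latticePoint] <;> ring

/-- The projection of the line of slope `s` through `b`, as a closed loop in the Conway sphere:
the class of `t` in `ℝ / ℤ` goes to the image of `b + 2 t (p, q)`. If the line misses `ℤ²`, this
runs once around the simple loop `α_s`; all such lines give isotopic loops. -/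
def slopeLoop (s : Slope) (b : ℝ × ℝ) : C(UnitAddCircle, ConwaySphere) where
  toFun := Function.Periodic.lift (f := fun t : ℝ => proj (b + (2 * t) • dir s)) (c := 1) (by
    intro t
    have h := proj_add_two_mul (b + (2 * t) • dir s) (slopeVec s)
    refine Eq.trans ?_ h
    change proj _ = proj _
    congr 1
    rw [dir, add_assoc, ← add_smul]
    ring_nf)
  continuous_toFun := by
    refine continuous_quot_lift _ ?_
    exact continuous_proj.comp (by fun_prop)

/-- The line of slope `s` through `b` lies in `ℝ² - ℤ²`. -/
def LineAvoidsLattice (s : Slope) (b : ℝ × ℝ) : Prop :=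
  ∀ t : ℝ, b + t • dir s ∉ lattice

/-! ### Rational tangles -/

/-- The relation that, on the inner end `1` of `ConwaySphere × [0, 1]`, shrinks the projection
of each line of slope `s` to a point. -/
def TangleRel (s : Slope) (x y : ConwaySphere × I) : Prop :=
  x.2 = 1 ∧ y.2 = 1 ∧ SameLeaf s x.1 y.1

/-- The 3-ball of the rational tangle of slope `s`: the mapping cylinder of the projection of
the Conway sphere to the space of leaves of slope `s`, which is a closed interval. The cylinder
over each closed leaf, a loop `α_s`, is a disk. So the ball is the union of an interval of
disks; this is `D² × [0, 1]` with both end disks `D² × {0}` and `D² × {1}` folded up along a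
diameter. The boundary sphere is the outer end `0`, with the identity as its marking. -/
def TangleBall (s : Slope) : Type := Quot (TangleRel s)

instance (s : Slope) : TopologicalSpace (TangleBall s) :=
  inferInstanceAs (TopologicalSpace (Quot (TangleRel s)))

/-- The inclusion of the boundary, the Conway sphere, in the ball. -/
def bdry (s : Slope) (x : ConwaySphere) : TangleBall s := Quot.mk (TangleRel s) (x, 0)

/-- The strands `t(s)`: the part of the mapping cylinder over the four marked points. The four
segments are joined in pairs at the inner end, because the two exceptional leaves of slope `s`
are arcs between marked points; in the folded `D² × [0, 1]` these are the two creases. Each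
strand is parallel to an arc of slope `s` in the boundary, and the loops `α_s` bound disks that
separate the strands. -/
def strands (s : Slope) : Set (TangleBall s) :=
  Quot.mk (TangleRel s) '' (punctures ×ˢ Set.univ)

/-! ### Two-bridge links -/

/-- Identification of the two boundary spheres through the identity of the Conway sphere. -/
inductive GlueRel (r : Slope) : TangleBall ∞ ⊕ TangleBall r → TangleBall ∞ ⊕ TangleBall r → Prop
  | glue (x : ConwaySphere) : GlueRel r (Sum.inl (bdry ∞ x)) (Sum.inr (bdry r x))

/-- The 3-sphere obtained from the balls of the rational tangles of slopes `∞` and `r` by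
identifying their boundaries. -/
def LinkSphere (r : Slope) : Type := Quot (GlueRel r)

instance (r : Slope) : TopologicalSpace (LinkSphere r) :=
  inferInstanceAs (TopologicalSpace (Quot (GlueRel r)))

/-- The 2-bridge link `K(r)`: the union of the strands of the two tangles. -/
def link (r : Slope) : Set (LinkSphere r) :=
  (fun x => Quot.mk (GlueRel r) (Sum.inl x)) '' strands ∞ ∪
    (fun x => Quot.mk (GlueRel r) (Sum.inr x)) '' strands r

/-- The inclusion of the Conway sphere, as the 2-bridge sphere, in the 3-sphere. -/
def bridgeSphere (r : Slope) : C(ConwaySphere, LinkSphere r) where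
  toFun x := Quot.mk (GlueRel r) (Sum.inl (bdry ∞ x))
  continuous_toFun :=
    continuous_quot_mk.comp (continuous_inl.comp
      (continuous_quot_mk.comp (by fun_prop : Continuous fun x : ConwaySphere => (x, (0 : I)))))

/-- Two loops in the 3-sphere are freely homotopic in the complement of `K(r)`: there is a
homotopy through loops which all miss `K(r)`. -/
def FreelyHomotopicInComplement (r : Slope) (γ γ' : C(UnitAddCircle, LinkSphere r)) : Prop :=
  ContinuousMap.HomotopicWith γ γ' fun f => ∀ x, f x ∉ link r

/-- The same for unoriented loops: one of them may be reversed. -/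
def UnorientedHomotopicInComplement (r : Slope) (γ γ' : C(UnitAddCircle, LinkSphere r)) : Prop :=
  FreelyHomotopicInComplement r γ γ' ∨
    FreelyHomotopicInComplement r γ (γ'.comp ⟨fun x => -x, continuous_neg⟩)

/-- The unoriented loops `α_s` and `α_s'` on the 2-bridge sphere are homotopic in `S³ - K(r)`,
whichever lines of slopes `s` and `s'` in `ℝ² - ℤ²` are used to define them. -/
def AlphaHomotopic (r s s' : Slope) : Prop :=
  ∀ b b' : ℝ × ℝ, LineAvoidsLattice s b → LineAvoidsLattice s' b' →
    UnorientedHomotopicInComplement r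
      ((bridgeSphere r).comp (slopeLoop s b)) ((bridgeSphere r).comp (slopeLoop s' b'))

end TwoBridge

end

/-!
The theorem combines a reduction algorithm on slopes with an explicit homotopy in a tangle ball.

*Orbits.* The group `Γ_∞` acts on the rationals as the group generated by the reflections in the
integers, so the map `fold` (distance to the nearest even integer) folds `ℚ` onto `[0, 1]` along
its orbits. The ends `r₁` and `r₂` span a Farey edge and `r` is their mediant
(`exists_farey_parents`). Hence a matrix `M` with integer entries and determinant `-1` takes
`(r₁, r, r₂)` to `(0, ∞, 1)`, and `M⁻¹ ∘ foldSlope ∘ M` folds the slopes onto the complement of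
`(r₁, r₂) - {r}` along the orbits of `Γ_r`. Every slope is fixed by one of the two folding maps,
because `(r₁, r₂)` lies in `[0, 1]`. Each folding map that moves a slope `s` strictly decreases
`Δ(s, ∞) + Δ(s, r)`, where `Δ` is the absolute determinant of primitive vectors: a fold brings `s`
closer to every point inside the fundamental interval (`abs_fold_sub_lt`). Folding as long as
possible therefore ends, and since at most one folding map moves a given slope, the result is
unchanged by both groups. So each orbit has a unique slope fixed by both maps
(`existsUnique_fixed_of_folds`), and these slopes form the set `fundSet`.

*Loops.* It suffices to treat the reflection in a Farey edge with ends `c` and `y`, for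
`c = ∞` and `c = r`. In the basis of the plane formed by the directions of `y` and `c`, it takes
the line `z = z₀ + κ x` to a line of slope `-κ`, for which `z = 1 - z₀ - κ x` may be used. At an
integer `x` the two heights lie in the open intervals `(j, j + 1)` and `(-j, -j + 1)`, which agree
modulo `2 ℤ²`. So the parts of the lines near the exceptional leaves can be moved to each other
without crossing a marked point, while the parts between exceptional leaves pass the inner end of
the mapping cylinder, where the height is irrelevant (`homotopic_raisedLoop_reflect`). The resulting
homotopy stays in one tangle ball and off its strands.
-/

noncomputable section

namespace TwoBridge

/-! ### Slopes as primitive integer vectors -/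

/-- The slope `q / p` of a vector `(p, q)`, with `q / 0 = ∞`. -/
def toSlope (p q : ℚ) : Slope := if p = 0 then ∞ else ((q / p : ℚ) : Slope)

@[simp] theorem slopeVec_infty : slopeVec ∞ = (0, 1) := rfl

@[simp] theorem slopeVec_coe (q : ℚ) : slopeVec (q : Slope) = ((q.den : ℤ), q.num) := rfl

theorem isCoprime_slopeVec (s : Slope) : IsCoprime (slopeVec s).1 (slopeVec s).2 := by
  induction s using OnePoint.rec with
  | infty => simp [isCoprime_one_right]
  | coe q =>
    rw [slopeVec_coe, Int.isCoprime_iff_nat_coprime]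
    simpa using q.reduced.symm

theorem slopeVec_ne (s : Slope) : ((slopeVec s).1 : ℚ) ≠ 0 ∨ ((slopeVec s).2 : ℚ) ≠ 0 := by
  induction s using OnePoint.rec <;> simp

theorem toSlope_slopeVec (s : Slope) : toSlope (slopeVec s).1 (slopeVec s).2 = s := by
  induction s using OnePoint.rec with
  | infty => simp [toSlope]
  | coe q => simp [toSlope, Rat.num_div_den]

theorem toSlope_eq_iff {p q p' q' : ℚ} (h : p ≠ 0 ∨ q ≠ 0) (h' : p' ≠ 0 ∨ q' ≠ 0) :
    toSlope p q = toSlope p' q' ↔ p * q' = q * p' := by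
  unfold toSlope
  by_cases hp : p = 0 <;> by_cases hp' : p' = 0 <;> simp_all
  rw [div_eq_div_iff hp hp', eq_comm, mul_comm q' p]

theorem smul_toSlope (g : GL (Fin 2) ℚ) {p q : ℚ} (h : p ≠ 0 ∨ q ≠ 0) :
    g • toSlope p q = toSlope (g 1 0 * q + g 1 1 * p) (g 0 0 * q + g 0 1 * p) := by
  unfold toSlope
  by_cases hp : p = 0
  · have hq : q ≠ 0 := by tauto
    subst hp
    simp only [if_true, OnePoint.smul_infty_eq_ite, mul_zero, add_zero, mul_eq_zero, hq, or_false]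
    rw [mul_div_mul_right _ _ hq]
  · rw [if_neg hp, OnePoint.smul_some_eq_ite]
    have h1 : g 1 0 * (q / p) + g 1 1 = (g 1 0 * q + g 1 1 * p) / p := by field_simp
    have h2 : g 0 0 * (q / p) + g 0 1 = (g 0 0 * q + g 0 1 * p) / p := by field_simp
    rw [h1, h2, div_div_div_cancel_right₀ hp]
    simp [hp]

theorem slopeVec_toSlope {p q : ℤ} (h : IsCoprime p q) :
    slopeVec (toSlope p q) = (p, q) ∨ slopeVec (toSlope p q) = (-p, -q) := by
  set s := toSlope p q with hs
  have hpq : (p : ℚ) ≠ 0 ∨ (q : ℚ) ≠ 0 := by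
    by_contra! hc
    have h1 : p = 0 := by exact_mod_cast hc.1
    have h2 : q = 0 := by exact_mod_cast hc.2
    subst h1 h2
    exact not_isCoprime_zero_zero h
  have he := (toSlope_eq_iff hpq (slopeVec_ne s)).1 (by rw [toSlope_slopeVec])
  have hc := isCoprime_slopeVec s
  generalize slopeVec s = S at *
  obtain ⟨a, b⟩ := S
  replace he : p * b = q * a := by exact_mod_cast he
  obtain ⟨u, v, huv⟩ := h
  obtain ⟨u', v', huv'⟩ := hc
  have ha : a = (u * a + v * b) * p := by linear_combination (-a) * huv - v * he
  have hb : b = (u * a + v * b) * q := by linear_combination (-b) * huv + u * he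
  have hk : (u * a + v * b) * (u' * p + v' * q) = 1 := by
    linear_combination huv' - u' * ha - v' * hb
  rcases Int.isUnit_iff.1 (IsUnit.of_mul_eq_one _ hk) with hk | hk
  · rw [hk] at ha hb; left; ext <;> simp [ha, hb]
  · rw [hk] at ha hb; right; ext <;> simp [ha, hb]

theorem slopeVec_injective : Function.Injective slopeVec := fun s t h => by
  rw [← toSlope_slopeVec s, h, toSlope_slopeVec]

theorem eq_of_slopeVec_eq_neg {s t : Slope}
    (h : slopeVec s = (-(slopeVec t).1, -(slopeVec t).2)) : s = t := by
  rw [← toSlope_slopeVec s, ← toSlope_slopeVec t, toSlope_eq_iff (slopeVec_ne s) (slopeVec_ne t), h]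
  push_cast; ring

/-- `|p q' - q p'|` for the slopes `q / p` and `q' / p'`: half the geometric intersection number
of the corresponding loops on the Conway sphere. -/
def slopeDist (x y : Slope) : ℤ :=
  |(slopeVec x).1 * (slopeVec y).2 - (slopeVec x).2 * (slopeVec y).1|

theorem slopeDist_nonneg (x y : Slope) : 0 ≤ slopeDist x y := abs_nonneg _

theorem isFareyEdge_iff {x y : Slope} : IsFareyEdge x y ↔ slopeDist x y = 1 := Iff.rfl

theorem slopeDist_comm (x y : Slope) : slopeDist x y = slopeDist y x := by
  unfold slopeDist
  rw [← abs_neg]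
  congr 1
  ring

theorem slopeDist_infty (q : ℚ) : slopeDist q ∞ = q.den := by
  simp [slopeDist]

theorem slopeDist_coe (x y : ℚ) : (slopeDist x y : ℚ) = x.den * y.den * |x - y| := by
  have h : (x.den : ℚ) * y.num - x.num * y.den = -(x.den * y.den * (x - y)) := by
    have hxn : (x.num : ℚ) = x * x.den := (Rat.mul_den_eq_num x).symm
    have hyn : (y.num : ℚ) = y * y.den := (Rat.mul_den_eq_num y).symm
    rw [hxn, hyn]
    ring
  simp only [slopeDist, slopeVec_coe]
  push_cast
  rw [h, abs_neg, abs_mul, abs_of_nonneg (by positivity)]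

/-- Primitive vectors stay primitive under a unimodular change of basis. -/
theorem isCoprime_comb {p q p' q' a b : ℤ} (hd : |p * q' - q * p'| = 1) (h : IsCoprime a b) :
    IsCoprime (a * p + b * p') (a * q + b * q') := by
  obtain ⟨u, v, huv⟩ := h
  have hd2 : (p * q' - q * p') ^ 2 = 1 := by rw [← sq_abs, hd]; rfl
  refine ⟨(p * q' - q * p') * (u * q' - v * q), (p * q' - q * p') * (v * p - u * p'), ?_⟩
  linear_combination (u * a + v * b) * hd2 + huv

theorem isCoprime_of_comb {p q p' q' a b : ℤ}
    (h : IsCoprime (a * p + b * p') (a * q + b * q')) : IsCoprime a b := by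
  obtain ⟨u, v, huv⟩ := h
  exact ⟨u * p + v * q, u * p' + v * q', by linear_combination huv⟩

/-- A slope is an integer combination of the ends of any Farey edge. -/
theorem exists_comb {x y : Slope} (h : IsFareyEdge x y) (s : Slope) :
    ∃ a b : ℤ, slopeVec s = a • slopeVec x + b • slopeVec y := by
  unfold IsFareyEdge at h
  generalize slopeVec x = X at *
  obtain ⟨p, q⟩ := X
  generalize slopeVec y = Y at *
  obtain ⟨p', q'⟩ := Y
  generalize slopeVec s = S at *
  obtain ⟨m, k⟩ := S
  simp only at h
  have hd2 : (p * q' - q * p') ^ 2 = 1 := by rw [← sq_abs, h]; rfl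
  refine ⟨(p * q' - q * p') * (m * q' - k * p'), (p * q' - q * p') * (p * k - q * m), ?_⟩
  ext
  · simp; linear_combination (-m) * hd2
  · simp; linear_combination (-k) * hd2

/-- The matrix of a reflection in a Farey edge is, up to sign, `diag (1, -1)` in the basis formed
by the ends of the edge. -/
theorem IsReflection.slopeVec_smul {g : GL (Fin 2) ℚ} {x y : Slope} (he : IsFareyEdge x y)
    (hg : IsReflection g x y) {s : Slope} {a b : ℤ}
    (hs : slopeVec s = a • slopeVec x + b • slopeVec y) :
    slopeVec (g • s) = a • slopeVec x - b • slopeVec y ∨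
      slopeVec (g • s) = -(a • slopeVec x - b • slopeVec y) := by
  obtain ⟨hdet, hsq, hx, hy⟩ := hg
  have eig : ∀ z : Slope, g • z = z → ∃ c : ℚ,
      g 1 0 * (slopeVec z).2 + g 1 1 * (slopeVec z).1 = c * (slopeVec z).1 ∧
      g 0 0 * (slopeVec z).2 + g 0 1 * (slopeVec z).1 = c * (slopeVec z).2 := by
    intro z hz
    have hne := slopeVec_ne z
    have hsm := smul_toSlope g hne
    rw [toSlope_slopeVec, hz] at hsm
    nth_rewrite 1 [← toSlope_slopeVec z] at hsm
    by_cases h0 : g 1 0 * (slopeVec z).2 + g 1 1 * (slopeVec z).1 = 0 ∧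
        g 0 0 * (slopeVec z).2 + g 0 1 * (slopeVec z).1 = 0
    · exact ⟨0, by simp [h0.1], by simp [h0.2]⟩
    · have h0' : g 1 0 * (slopeVec z).2 + g 1 1 * (slopeVec z).1 ≠ 0 ∨
        g 0 0 * (slopeVec z).2 + g 0 1 * (slopeVec z).1 ≠ 0 := by tauto
      rw [toSlope_eq_iff hne h0'] at hsm
      rcases hne with h | h
      · refine ⟨(g 1 0 * (slopeVec z).2 + g 1 1 * (slopeVec z).1) / (slopeVec z).1, ?_, ?_⟩
        · field_simp
        · field_simp; linear_combination hsm
      · refine ⟨(g 0 0 * (slopeVec z).2 + g 0 1 * (slopeVec z).1) / (slopeVec z).2, ?_, ?_⟩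
        · field_simp; linear_combination -hsm
        · field_simp
  obtain ⟨c, hc1, hc2⟩ := eig x hx
  obtain ⟨d, hd1, hd2⟩ := eig y hy
  have hco := isCoprime_slopeVec s
  have hne := slopeVec_ne s
  have hsm := smul_toSlope g hne
  rw [toSlope_slopeVec] at hsm
  have hxne := slopeVec_ne x
  unfold IsFareyEdge at he
  generalize slopeVec x = X at *
  obtain ⟨p, q⟩ := X
  generalize slopeVec y = Y at *
  obtain ⟨p', q'⟩ := Y
  have hs1 : (slopeVec s).1 = a * p + b * p' := by rw [hs]; simp
  have hs2 : (slopeVec s).2 = a * q + b * q' := by rw [hs]; simp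
  simp only at he hc1 hc2 hd1 hd2 hxne
  rw [hs1, hs2] at hco hsm
  have hsq' : ∀ i j, (g * g) i j = (1 : GL (Fin 2) ℚ) i j := by rw [hsq]; simp
  have e00 := hsq' 0 0
  have e01 := hsq' 0 1
  have e10 := hsq' 1 0
  have e11 := hsq' 1 1
  simp [Matrix.mul_apply, Fin.sum_univ_two] at e00 e01 e10 e11
  rw [Matrix.det_fin_two] at hdet
  have hD2 : ((p : ℚ) * q' - q * p') ^ 2 = 1 := by
    have : (p * q' - q * p') ^ 2 = 1 := by rw [← sq_abs, he]; rfl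
    exact_mod_cast this
  have hD : ((p : ℚ) * q' - q * p') ≠ 0 := by
    intro h; rw [h] at hD2; norm_num at hD2
  -- the product of the two eigenvalues is the determinant
  have hcd : c * d = -1 := by
    have : (c * d) * ((p : ℚ) * q' - q * p') = (-1) * ((p : ℚ) * q' - q * p') := by
      rw [← hdet]
      linear_combination (-d * q') * hc1 + (d * p') * hc2 - (g 0 0 * q + g 0 1 * p) * (-hd1)
        - (g 1 0 * q + g 1 1 * p) * hd2
    exact mul_right_cancel₀ hD this
  have hcc : c ^ 2 = 1 := by
    have h1 : c ^ 2 * p = 1 * p := by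
      linear_combination (-c - g 1 1) * hc1 - g 1 0 * hc2 + q * e10 + p * e11
    have h2 : c ^ 2 * q = 1 * q := by
      linear_combination (-g 0 1) * hc1 + (-c - g 0 0) * hc2 + q * e00 + p * e01
    rcases hxne with h | h
    · exact mul_right_cancel₀ h h1
    · exact mul_right_cancel₀ h h2
  have hdc : d = -c := by linear_combination c * hcd - d * hcc
  have hc0 : c ≠ 0 := by rintro rfl; norm_num at hcc
  have hco' : IsCoprime (a * p - b * p') (a * q - b * q') := by
    have := isCoprime_comb he ((isCoprime_of_comb hco).neg_right)
    convert this using 1 <;> ring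
  have hgs : g • s = toSlope ((a * p - b * p' : ℤ)) ((a * q - b * q' : ℤ)) := by
    rw [hsm]
    have e1 : g 1 0 * ((a * q + b * q' : ℤ) : ℚ) + g 1 1 * ((a * p + b * p' : ℤ) : ℚ)
        = c * ((a * p - b * p' : ℤ) : ℚ) := by
      push_cast; rw [hdc] at hd1; linear_combination a * hc1 + b * hd1
    have e2 : g 0 0 * ((a * q + b * q' : ℤ) : ℚ) + g 0 1 * ((a * p + b * p' : ℤ) : ℚ)
        = c * ((a * q - b * q' : ℤ) : ℚ) := by
      push_cast; rw [hdc] at hd2; linear_combination a * hc2 + b * hd2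
    rw [e1, e2]
    simp only [toSlope, mul_eq_zero, hc0, false_or]
    rw [mul_div_mul_left _ _ hc0]
  rw [hgs]
  simpa using slopeVec_toSlope hco'

/-- There is a reflection in every Farey edge. -/
theorem exists_isReflection {x y : Slope} (he : IsFareyEdge x y) :
    ∃ g : GL (Fin 2) ℚ, IsReflection g x y := by
  have hx := toSlope_slopeVec x
  have hy := toSlope_slopeVec y
  have hxne := slopeVec_ne x
  have hyne := slopeVec_ne y
  unfold IsFareyEdge at he
  generalize slopeVec x = X at *
  obtain ⟨p, q⟩ := X
  generalize slopeVec y = Y at *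
  obtain ⟨p', q'⟩ := Y
  simp only at hx hy he hxne hyne
  have hD2 : ((p : ℚ) * q' - q * p') ^ 2 = 1 := by
    have : (p * q' - q * p') ^ 2 = 1 := by rw [← sq_abs, he]; rfl
    exact_mod_cast this
  set A : Matrix (Fin 2) (Fin 2) ℚ :=
    !![-(p * q' + q * p'), 2 * q * q'; -(2 * p * p'), p * q' + q * p'] with hA
  have hdet : A.det = -1 := by
    rw [hA, Matrix.det_fin_two_of]; linear_combination -hD2
  have hAA : A * A = 1 := by
    rw [hA, Matrix.mul_fin_two, Matrix.one_fin_two]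
    congr! 2
    · ext i; fin_cases i
      · simp; linear_combination hD2
      · simp; ring
    · ext i j; fin_cases i; fin_cases j
      · simp; ring
      · simp; linear_combination hD2
  have hne : ∀ z : ℚ, z ^ 2 = 1 → z ≠ 0 := by rintro z h rfl; norm_num at h
  have hfix : ∀ (a b : ℤ) (s : Slope), toSlope a b = s → ((a : ℚ) ≠ 0 ∨ (b : ℚ) ≠ 0) →
      ((∃ c : ℚ, c ≠ 0 ∧ A 1 0 * b + A 1 1 * a = c * a ∧ A 0 0 * b + A 0 1 * a = c * b)) →
      (⟨A, A, hAA, hAA⟩ : GL (Fin 2) ℚ) • s = s := by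
    rintro a b s rfl hab ⟨c, hc, h1, h2⟩
    rw [smul_toSlope _ hab]
    dsimp only
    rw [h1, h2, toSlope, toSlope, mul_div_mul_left _ _ hc]
    simp [hc]
  refine ⟨⟨A, A, hAA, hAA⟩, hdet, Units.ext hAA, hfix _ _ _ hx hxne ?_, hfix _ _ _ hy hyne ?_⟩
  · refine ⟨p * q' - q * p', hne _ hD2, ?_, ?_⟩ <;> simp [hA] <;> ring
  · refine ⟨-(p * q' - q * p'), neg_ne_zero.2 (hne _ hD2), ?_, ?_⟩ <;> simp [hA] <;> ring

/-! ### Orbits of a group generated by two subgroups with folding maps -/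

/-- The elements of a group that move every point within its class for an equivalence relation. -/
def classStabilizer {G X : Type*} [Group G] [MulAction G X] (R : Setoid X) : Subgroup G where
  carrier := {g | ∀ x, R (g • x) x}
  one_mem' x := by rw [one_smul]
  mul_mem' {g h} hg hh x := by rw [mul_smul]; exact R.trans (hg _) (hh x)
  inv_mem' {g} hg x := by simpa using R.symm (hg (g⁻¹ • x))

/-- Suppose that each of two groups has a map that folds the space onto a fundamental domain, that
every point lies in one of the two domains, and that folding decreases a complexity. Then the
intersection of the domains is a fundamental domain of the group that they generate. -/
theorem existsUnique_fixed_of_folds {G X : Type*} [Group G] [MulAction G X]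
    (G₁ G₂ : Subgroup G) (N₁ N₂ : X → X) (μ : X → ℕ)
    (inv₁ : ∀ g ∈ G₁, ∀ x, N₁ (g • x) = N₁ x) (inv₂ : ∀ g ∈ G₂, ∀ x, N₂ (g • x) = N₂ x)
    (orb₁ : ∀ x, ∃ g ∈ G₁, g • x = N₁ x) (orb₂ : ∀ x, ∃ g ∈ G₂, g • x = N₂ x)
    (cover : ∀ x, N₁ x = x ∨ N₂ x = x)
    (dec₁ : ∀ x, N₁ x ≠ x → μ (N₁ x) < μ x) (dec₂ : ∀ x, N₂ x ≠ x → μ (N₂ x) < μ x) (s : X) :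
    ∃! s₀ : X, (N₁ s₀ = s₀ ∧ N₂ s₀ = s₀) ∧
      s ∈ MulAction.orbit (G₁ ⊔ G₂ : Subgroup G) s₀ := by
  classical
  set step : X → X := fun x => if N₁ x = x then N₂ x else N₁ x with hstep
  have hdec : ∀ x, step x ≠ x → μ (step x) < μ x := by
    intro x hx
    by_cases h : N₁ x = x
    · simp only [hstep, h, if_true] at hx ⊢; exact dec₂ x hx
    · simp only [hstep, h, if_false] at hx ⊢; exact dec₁ x hx
  -- the result of folding as long as possible
  set ρ : X → X := (measure μ).wf.fix
    (fun x ih => if h : μ (step x) < μ x then ih (step x) h else x) with hρ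
  have ρ_eq : ∀ x, ρ x = if μ (step x) < μ x then ρ (step x) else x := by
    intro x
    rw [hρ, WellFounded.fix_eq]
    rfl
  have ρ_step : ∀ x, ρ (step x) = ρ x := by
    intro x
    by_cases h : step x = x
    · rw [h]
    · rw [ρ_eq x, if_pos (hdec x h)]
  have ρ_fix : ∀ x, N₁ x = x → N₂ x = x → ρ x = x := by
    intro x h1 h2
    rw [ρ_eq, if_neg]
    simp [hstep, h1, h2]
  have ρ_N₁ : ∀ x, ρ (N₁ x) = ρ x := by
    intro x
    by_cases h : N₁ x = x
    · rw [h]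
    · rw [← ρ_step x]; simp [hstep, h]
  have ρ_N₂ : ∀ x, ρ (N₂ x) = ρ x := by
    intro x
    by_cases h : N₁ x = x
    · rw [← ρ_step x]; simp [hstep, h]
    · rw [(cover x).resolve_left h]
  have ρ_inv : ∀ g ∈ G₁ ⊔ G₂, ∀ x, ρ (g • x) = ρ x := by
    have : G₁ ⊔ G₂ ≤ classStabilizer (Setoid.ker ρ) := sup_le
      (fun g hg x => by
        change ρ _ = ρ _
        rw [← ρ_N₁, inv₁ g hg, ρ_N₁])
      (fun g hg x => by
        change ρ _ = ρ _
        rw [← ρ_N₂, inv₂ g hg, ρ_N₂])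
    exact fun g hg x => this hg x
  have ρ_spec : ∀ n x, μ x = n → (N₁ (ρ x) = ρ x ∧ N₂ (ρ x) = ρ x) ∧
      ∃ g ∈ G₁ ⊔ G₂, g • x = ρ x := by
    intro n
    induction n using Nat.strong_induction_on with
    | _ n ih =>
      rintro x rfl
      by_cases h1 : N₁ x = x
      · by_cases h2 : N₂ x = x
        · rw [ρ_fix x h1 h2]; exact ⟨⟨h1, h2⟩, 1, one_mem _, one_smul _ _⟩
        · obtain ⟨hf, g, hg, hgx⟩ := ih _ (dec₂ x h2) _ rfl
          rw [ρ_N₂] at hf hgx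
          obtain ⟨k, hk, hkx⟩ := orb₂ x
          exact ⟨hf, g * k, mul_mem hg (Subgroup.mem_sup_right hk), by rw [mul_smul, hkx, hgx]⟩
      · obtain ⟨hf, g, hg, hgx⟩ := ih _ (dec₁ x h1) _ rfl
        rw [ρ_N₁] at hf hgx
        obtain ⟨k, hk, hkx⟩ := orb₁ x
        exact ⟨hf, g * k, mul_mem hg (Subgroup.mem_sup_left hk), by rw [mul_smul, hkx, hgx]⟩
  obtain ⟨hf, g, hg, hgx⟩ := ρ_spec _ s rfl
  refine ⟨ρ s, ⟨hf, ⟨g⁻¹, inv_mem hg⟩, ?_⟩, ?_⟩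
  · change g⁻¹ • ρ s = s
    rw [← hgx, inv_smul_smul]
  · rintro t ⟨⟨h1, h2⟩, ⟨k, hk⟩, hks⟩
    change k • t = s at hks
    rw [← hks, ρ_inv k hk, ρ_fix t h1 h2]

/-! ### Folding the slopes onto the unit interval -/

/-- The distance to the nearest even integer: the folding map of the real line onto `[0, 1]` along
the integers. -/
def fold (x : ℚ) : ℚ := |x - 2 * round (x / 2)|

theorem fold_nonneg (x : ℚ) : 0 ≤ fold x := abs_nonneg _

theorem fold_le_one (x : ℚ) : fold x ≤ 1 := by
  have h := abs_sub_round (x / 2)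
  rw [fold, show x - 2 * round (x / 2) = 2 * (x / 2 - round (x / 2)) by ring, abs_mul]
  norm_num at h ⊢
  linarith

theorem exists_fold_eq (x : ℚ) : ∃ k : ℤ, fold x = x - 2 * k ∨ fold x = 2 * k - x := by
  refine ⟨round (x / 2), ?_⟩
  rcases abs_choice (x - 2 * round (x / 2)) with h | h
  · left; exact h
  · right; rw [fold, h]; ring

theorem eq_fold {x y : ℚ} (h0 : 0 ≤ y) (h1 : y ≤ 1)
    (h : ∃ k : ℤ, y = x - 2 * k ∨ y = 2 * k - x) : fold x = y := by
  obtain ⟨k, hk⟩ := h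
  obtain ⟨m, hm⟩ := exists_fold_eq x
  have h0' := fold_nonneg x
  have h1' := fold_le_one x
  have key : ∀ j : ℤ, (fold x - y = 2 * j ∨ fold x + y = 2 * j) → fold x = y := by
    intro j hj
    have hj1 : (-1 : ℚ) < j := by rcases hj with hj | hj <;> linarith
    have hj2 : (j : ℚ) < 2 := by rcases hj with hj | hj <;> linarith
    have hj1' : -1 < j := by exact_mod_cast hj1
    have hj2' : j < 2 := by exact_mod_cast hj2
    obtain rfl | rfl : j = 0 ∨ j = 1 := by omega
    all_goals norm_num at hj; rcases hj with hj | hj <;> linarith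
  rcases hk with hk | hk <;> rcases hm with hm | hm
  · exact key (k - m) (Or.inl (by push_cast; linarith))
  · exact key (m - k) (Or.inr (by push_cast; linarith))
  · exact key (k - m) (Or.inr (by push_cast; linarith))
  · exact key (m - k) (Or.inl (by push_cast; linarith))

theorem fold_eq_self_iff {x : ℚ} : fold x = x ↔ 0 ≤ x ∧ x ≤ 1 :=
  ⟨fun h => h ▸ ⟨fold_nonneg x, fold_le_one x⟩, fun h => eq_fold h.1 h.2 ⟨0, by simp⟩⟩

theorem fold_reflect (n : ℤ) (x : ℚ) : fold (2 * n - x) = fold x := by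
  refine eq_fold (fold_nonneg x) (fold_le_one x) ?_
  obtain ⟨k, hk | hk⟩ := exists_fold_eq x
  · exact ⟨n - k, Or.inr (by push_cast; linarith)⟩
  · exact ⟨n - k, Or.inl (by push_cast; linarith)⟩

theorem den_fold (x : ℚ) : (fold x).den = x.den := by
  obtain ⟨k, hk | hk⟩ := exists_fold_eq x
  · rw [hk]
    have := Rat.sub_intCast_den x (2 * k)
    push_cast at this
    exact this
  · rw [hk, ← Rat.neg_den, neg_sub]
    have := Rat.sub_intCast_den x (2 * k)
    push_cast at this
    exact this

theorem abs_fold_sub_lt {x q : ℚ} (hx : ¬(0 ≤ x ∧ x ≤ 1)) (h0 : 0 < q) (h1 : q < 1) :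
    |fold x - q| < |x - q| := by
  have hf0 := fold_nonneg x
  have hf1 := fold_le_one x
  obtain ⟨k, hk⟩ := exists_fold_eq x
  by_cases hx0 : 0 ≤ x
  · have hx1 : 1 < x := by by_contra! h; exact hx ⟨hx0, h⟩
    have hk1 : (1 : ℚ) ≤ k := by
      by_contra! h
      have h' : k < 1 := by exact_mod_cast h
      have h'' : (k : ℚ) ≤ 0 := by exact_mod_cast Int.lt_add_one_iff.1 h'
      rcases hk with hk | hk <;> linarith
    rw [abs_of_pos (by linarith : 0 < x - q), abs_lt]
    constructor <;> rcases hk with hk | hk <;> linarith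
  · push Not at hx0
    have hk1 : (k : ℚ) ≤ 0 := by
      by_contra! h
      have h' : 0 < k := by exact_mod_cast h
      have h'' : (1 : ℚ) ≤ k := by exact_mod_cast h'
      rcases hk with hk | hk <;> linarith
    rw [abs_of_neg (by linarith : x - q < 0), abs_lt]
    refine ⟨by linarith, ?_⟩
    rcases hk with hk | hk
    · have hk2 : (k : ℚ) < 0 := by linarith
      have hk2' : k ≤ -1 := by
        have : k < 0 := by exact_mod_cast hk2
        omega
      have hk3 : (k : ℚ) ≤ -1 := by exact_mod_cast hk2'
      linarith
    · linarith

/-- The folding map on slopes, which fixes `∞`. -/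
def foldSlope : Slope → Slope := OnePoint.map fold

@[simp] theorem foldSlope_infty : foldSlope ∞ = ∞ := rfl

@[simp] theorem foldSlope_coe (x : ℚ) : foldSlope x = (fold x : ℚ) := rfl

theorem foldSlope_eq_self_iff {s : Slope} :
    foldSlope s = s ↔ s = ∞ ∨ ∃ x : ℚ, s = x ∧ 0 ≤ x ∧ x ≤ 1 := by
  induction s using OnePoint.rec with
  | infty => simp
  | coe x => simp [fold_eq_self_iff]

theorem slopeDist_foldSlope_lt {s : Slope} (hs : foldSlope s ≠ s) {q : ℚ} (h0 : 0 < q)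
    (h1 : q < 1) :
    slopeDist (foldSlope s) ∞ + slopeDist (foldSlope s) q < slopeDist s ∞ + slopeDist s q := by
  induction s using OnePoint.rec with
  | infty => exact absurd rfl hs
  | coe x =>
    have hx : ¬(0 ≤ x ∧ x ≤ 1) := by simpa [fold_eq_self_iff] using hs
    have hlt : (slopeDist (fold x : ℚ) q : ℚ) < slopeDist x q := by
      rw [slopeDist_coe, slopeDist_coe, den_fold]
      exact mul_lt_mul_of_pos_left (abs_fold_sub_lt hx h0 h1)
        (mul_pos (by exact_mod_cast x.den_pos) (by exact_mod_cast q.den_pos))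
    have hlt' : slopeDist (fold x : ℚ) q < slopeDist x q := by exact_mod_cast hlt
    rw [foldSlope_coe, slopeDist_infty, slopeDist_infty, den_fold]
    linarith

theorem isFareyEdge_infty_iff {y : Slope} :
    IsFareyEdge ∞ y ↔ ∃ n : ℤ, y = ((n : ℚ) : Slope) := by
  induction y using OnePoint.rec with
  | infty => simp [IsFareyEdge]
  | coe q =>
    simp only [IsFareyEdge, slopeVec_infty, slopeVec_coe, OnePoint.coe_eq_coe]
    constructor
    · intro h
      refine ⟨q.num, ?_⟩
      have : q.den = 1 := by simpa using h
      exact ((Rat.den_eq_one_iff q).1 this).symm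
    · rintro ⟨n, rfl⟩
      simp

theorem IsReflection.smul_infty {g : GL (Fin 2) ℚ} {n : ℤ} (hg : IsReflection g ∞ ((n : ℚ) : Slope))
    (x : ℚ) : g • (x : Slope) = ((2 * n - x : ℚ) : Slope) := by
  have hs : slopeVec (x : Slope) = (x.num - n * x.den) • slopeVec ∞ +
      (x.den : ℤ) • slopeVec ((n : ℚ) : Slope) := by
    ext <;> simp; ring
  have h := hg.slopeVec_smul (isFareyEdge_infty_iff.2 ⟨n, rfl⟩) hs
  have hd : (x.den : ℚ) ≠ 0 := by simp
  have hxn : (x.num : ℚ) = x * x.den := (Rat.mul_den_eq_num x).symm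
  have h' : slopeVec (g • (x : Slope)) = (-(x.den : ℤ), x.num - 2 * n * x.den) ∨
      slopeVec (g • (x : Slope)) = ((x.den : ℤ), -(x.num - 2 * n * x.den)) := by
    rcases h with h | h
    · left; rw [h]; ext <;> simp; ring
    · right; rw [h]; ext <;> simp; ring
  rw [← toSlope_slopeVec (g • (x : Slope))]
  rcases h' with h' | h'
  all_goals
    rw [h', toSlope, if_neg (by simp), OnePoint.coe_eq_coe]
    push_cast
    rw [hxn]
    field_simp
    ring

theorem foldSlope_smul {g : GL (Fin 2) ℚ} (hg : g ∈ Gam ∞) (s : Slope) :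
    foldSlope (g • s) = foldSlope s := by
  suffices h : Gam ∞ ≤ classStabilizer (Setoid.ker foldSlope) from h hg s
  refine (Subgroup.closure_le _).2 ?_
  rintro g ⟨y, hy, hg⟩ s
  obtain ⟨n, rfl⟩ := isFareyEdge_infty_iff.1 hy
  change foldSlope _ = foldSlope _
  induction s using OnePoint.rec with
  | infty => rw [hg.2.2.1]
  | coe x => rw [hg.smul_infty, foldSlope_coe, fold_reflect, foldSlope_coe]

theorem exists_smul_eq_foldSlope (s : Slope) : ∃ g ∈ Gam ∞, g • s = foldSlope s := by
  induction s using OnePoint.rec with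
  | infty => exact ⟨1, one_mem _, one_smul _ _⟩
  | coe x =>
    have refl : ∀ n : ℤ, ∃ g ∈ Gam ∞, ∀ z : ℚ, g • (z : Slope) = ((2 * n - z : ℚ) : Slope) := by
      intro n
      have he := isFareyEdge_infty_iff.2 ⟨n, rfl⟩
      obtain ⟨g, hg⟩ := exists_isReflection he
      exact ⟨g, Subgroup.subset_closure ⟨_, he, hg⟩, hg.smul_infty⟩
    obtain ⟨k, hk | hk⟩ := exists_fold_eq x
    · obtain ⟨g, hg, hgz⟩ := refl k
      obtain ⟨g', hg', hgz'⟩ := refl 0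
      refine ⟨g' * g, mul_mem hg' hg, ?_⟩
      rw [mul_smul, hgz, hgz', foldSlope_coe, hk]
      congr 1
      push_cast
      ring
    · obtain ⟨g, hg, hgz⟩ := refl k
      exact ⟨g, hg, by rw [hgz, foldSlope_coe, hk]⟩

/-! ### Isometries of the Farey tessellation -/

theorem slopeVec_smul_of_int {g : GL (Fin 2) ℚ} {a b c d : ℤ} (h : |a * d - b * c| = 1)
    (ha : g 0 0 = a) (hb : g 0 1 = b) (hc : g 1 0 = c) (hd : g 1 1 = d) (s : Slope) :
    slopeVec (g • s) = (c * (slopeVec s).2 + d * (slopeVec s).1,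
        a * (slopeVec s).2 + b * (slopeVec s).1) ∨
      slopeVec (g • s) = (-(c * (slopeVec s).2 + d * (slopeVec s).1),
        -(a * (slopeVec s).2 + b * (slopeVec s).1)) := by
  have hs := smul_toSlope g (slopeVec_ne s)
  rw [toSlope_slopeVec, ha, hb, hc, hd] at hs
  rw [hs]
  have h' : |d * a - b * c| = 1 := by rw [← h]; congr 1; ring
  have hco := isCoprime_comb (p := d) (q := b) (p' := c) (q' := a) h' (isCoprime_slopeVec s)
  have := slopeVec_toSlope hco
  push_cast at this
  convert this using 2 <;> ring_nf

theorem slopeDist_smul_of_int {g : GL (Fin 2) ℚ} {a b c d : ℤ} (h : |a * d - b * c| = 1)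
    (ha : g 0 0 = a) (hb : g 0 1 = b) (hc : g 1 0 = c) (hd : g 1 1 = d) (x y : Slope) :
    slopeDist (g • x) (g • y) = slopeDist x y := by
  have hx := slopeVec_smul_of_int h ha hb hc hd x
  have hy := slopeVec_smul_of_int h ha hb hc hd y
  have key : slopeDist x y = |a * d - b * c| * slopeDist x y := by rw [h, one_mul]
  rw [key]
  unfold slopeDist
  rw [← abs_mul]
  rcases hx with hx | hx <;> rcases hy with hy | hy <;> rw [hx, hy] <;> dsimp only
  · congr 1; ring
  · rw [← abs_neg]; congr 1; ring
  · rw [← abs_neg]; congr 1; ring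
  · congr 1; ring

theorem conj_mem_Gam {M : GL (Fin 2) ℚ} (hM : ∀ x y, slopeDist (M • x) (M • y) = slopeDist x y)
    {r : Slope} {g : GL (Fin 2) ℚ} (hg : g ∈ Gam r) : M * g * M⁻¹ ∈ Gam (M • r) := by
  suffices h : Gam r ≤ (Gam (M • r)).comap (MulAut.conj M).toMonoidHom from h hg
  refine (Subgroup.closure_le _).2 ?_
  rintro g ⟨y, hy, hdet, hsq, hr, hgy⟩
  refine Subgroup.subset_closure ⟨M • y, ?_, ?_, ?_, ?_, ?_⟩
  · rwa [isFareyEdge_iff, hM]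
  · have h1 : (M : Matrix (Fin 2) (Fin 2) ℚ).det * (M⁻¹ : GL (Fin 2) ℚ).val.det = 1 := by
      rw [← Matrix.det_mul, ← Units.val_mul, mul_inv_cancel, Units.val_one, Matrix.det_one]
    simp only [MulEquiv.coe_toMonoidHom, MulAut.conj_apply, Units.val_mul, Matrix.det_mul]
    rw [hdet]
    linear_combination -h1
  · rw [← map_mul, hsq, map_one]
  · simp [mul_smul, hr]
  · simp [mul_smul, hgy]

/-! ### Continued fractions and the Farey parents -/

/-- The continued fraction as a unimodular fractional linear map of its last entry. Its value at
`∞` is the continued fraction without the last entry. -/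
theorem exists_contFrac_append (l : List ℕ) (hl : ∀ m ∈ l, 1 ≤ m) :
    ∃ a b c d : ℤ, 0 ≤ a ∧ 0 ≤ b ∧ 0 < c ∧ 0 ≤ d ∧ a ≤ c ∧ a + b ≤ c + d ∧
      b * c - a * d = (-1) ^ l.length ∧ contFrac l = a / c ∧
      ∀ n : ℕ, 1 ≤ n → contFrac (l ++ [n]) = (a * n + b) / (c * n + d) := by
  induction l with
  | nil =>
    exact ⟨0, 1, 1, 0, by simp [contFrac]⟩
  | cons m l ih =>
    obtain ⟨a, b, c, d, ha, hb, hc, hd, hac, habcd, hdet, hl0, hln⟩ :=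
      ih fun x hx => hl x (List.mem_cons_of_mem _ hx)
    have hm : (1 : ℤ) ≤ m := by exact_mod_cast hl m List.mem_cons_self
    have hcq : (0 : ℚ) < c := by exact_mod_cast hc
    have hdq : (0 : ℚ) ≤ d := by exact_mod_cast hd
    have haq : (0 : ℚ) ≤ a := by exact_mod_cast ha
    have hbq : (0 : ℚ) ≤ b := by exact_mod_cast hb
    have hmq : (1 : ℚ) ≤ m := by exact_mod_cast hm
    refine ⟨c, d, m * c + a, m * d + b, hc.le, hd, by positivity, by positivity, by nlinarith,
      by nlinarith, ?_, ?_, ?_⟩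
    · rw [List.length_cons, pow_succ, ← hdet]; ring
    · rw [contFrac, hl0]
      push_cast
      field_simp
    · intro n hn
      have hnq : (1 : ℚ) ≤ n := by exact_mod_cast hn
      have h1 : (0 : ℚ) < c * n + d := by positivity
      rw [List.cons_append, contFrac, hln n hn]
      push_cast
      field_simp
      ring

/-- The ends `r₁ = q₁ / p₁` and `r₂ = q₂ / p₂` span a Farey edge, and `r` is their mediant. -/
theorem exists_farey_parents {l : List ℕ} {n : ℕ} (hl : ∀ m ∈ l, 1 ≤ m) (hn : 2 ≤ n) :
    ∃ p₁ q₁ p₂ q₂ : ℤ, 0 < p₁ ∧ 0 < p₂ ∧ 0 ≤ q₁ ∧ q₂ ≤ p₂ ∧ p₁ * q₂ - q₁ * p₂ = 1 ∧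
      rOne l n = q₁ / p₁ ∧ rTwo l n = q₂ / p₂ ∧
      contFrac (l ++ [n]) = (q₁ + q₂) / (p₁ + p₂) := by
  obtain ⟨a, b, c, d, ha, hb, hc, hd, hac, habcd, hdet, hl0, hln⟩ := exists_contFrac_append l hl
  have hn2 : (2 : ℤ) ≤ n := by exact_mod_cast hn
  have h1 := hln (n - 1) (by omega)
  have h2 := hln n (by omega)
  rw [Nat.cast_sub (by omega), Nat.cast_one] at h1
  have hp : 0 < c * ((n : ℤ) - 1) + d := by nlinarith
  have hq : 0 ≤ a * ((n : ℤ) - 1) + b := by nlinarith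
  have hqp : a * ((n : ℤ) - 1) + b ≤ c * ((n : ℤ) - 1) + d := by nlinarith
  by_cases he : Even l.length
  · rw [he.neg_one_pow] at hdet
    refine ⟨c, a, c * ((n : ℤ) - 1) + d, a * ((n : ℤ) - 1) + b, hc, hp, ha, hqp,
      by linear_combination hdet, ?_, ?_, ?_⟩
    · rw [rOne, if_pos he, hl0]
    · rw [rTwo, if_pos he, h1]; push_cast; rfl
    · rw [h2]; push_cast; congr 1 <;> ring
  · rw [(Nat.not_even_iff_odd.1 he).neg_one_pow] at hdet
    refine ⟨c * ((n : ℤ) - 1) + d, a * ((n : ℤ) - 1) + b, c, a, hp, hc, hq, hac,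
      by linear_combination -hdet, ?_, ?_, ?_⟩
    · rw [rOne, if_neg he, h1]; push_cast; rfl
    · rw [rTwo, if_neg he, hl0]
    · rw [h2]; push_cast; congr 1 <;> ring

/-! ### The fundamental set of the group `Γ̂_r` -/

theorem existsUnique_mem_fundSet {r : ℚ} (hr0 : 0 < r) (hr1 : r < 1) {l : List ℕ} {n : ℕ}
    (hl : ∀ m ∈ l, 1 ≤ m) (hn : 2 ≤ n) (hr : r = contFrac (l ++ [n])) (s : Slope) :
    ∃! s₀ : Slope, s₀ ∈ fundSet l n ∧ s ∈ MulAction.orbit (GamHat (r : Slope)) s₀ := by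
  obtain ⟨p₁, q₁, p₂, q₂, hp₁, hp₂, hq₁, hq₂, hdet, hr₁, hr₂, hm⟩ := exists_farey_parents hl hn
  rw [← hr] at hm
  have hp₁' : (0 : ℚ) < p₁ := by exact_mod_cast hp₁
  have hp₂' : (0 : ℚ) < p₂ := by exact_mod_cast hp₂
  have hq₁' : (0 : ℚ) ≤ q₁ := by exact_mod_cast hq₁
  have hq₂' : (q₂ : ℚ) ≤ p₂ := by exact_mod_cast hq₂
  have hdet' : (p₁ : ℚ) * q₂ - q₁ * p₂ = 1 := by exact_mod_cast hdet
  have hrp : r * (p₁ + p₂) = q₁ + q₂ := by rw [hm]; field_simp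
  have hr₁p : rOne l n * p₁ = q₁ := by rw [hr₁]; field_simp
  have hr₂p : rTwo l n * p₂ = q₂ := by rw [hr₂]; field_simp
  have hr₁0 : 0 ≤ rOne l n := by rw [hr₁]; positivity
  have hr₂1 : rTwo l n ≤ 1 := by rw [hr₂, div_le_one hp₂']; exact hq₂'
  have hlt₁ : rOne l n < r := by
    rw [hr₁, hm, div_lt_div_iff₀ hp₁' (by positivity)]; linarith
  have hlt₂ : r < rTwo l n := by
    rw [hr₂, hm, div_lt_div_iff₀ (by positivity) hp₂']; linarith
  clear hr₁ hr₂ hm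
  -- the isometry of the tessellation that takes `(r₁, r, r₂)` to `(0, ∞, 1)`
  set M : GL (Fin 2) ℚ := Matrix.GeneralLinearGroup.mkOfDetNeZero
    !![(p₁ : ℚ), -q₁; p₁ + p₂, -(q₁ + q₂)] (by
      rw [Matrix.det_fin_two_of]
      intro h
      have : (p₁ : ℚ) * q₂ - q₁ * p₂ = 0 := by linear_combination -h
      rw [hdet'] at this
      exact one_ne_zero this) with hMdef
  have hM00 : M 0 0 = p₁ := rfl
  have hM01 : M 0 1 = -q₁ := rfl
  have hM10 : M 1 0 = p₁ + p₂ := rfl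
  have hM11 : M 1 1 = -(q₁ + q₂) := rfl
  have hM : ∀ x y, slopeDist (M • x) (M • y) = slopeDist x y :=
    slopeDist_smul_of_int (a := p₁) (b := -q₁) (c := p₁ + p₂) (d := -(q₁ + q₂))
      (by rw [show p₁ * -(q₁ + q₂) - -q₁ * (p₁ + p₂) = -1 by linear_combination -hdet]; rfl)
      hM00 (by rw [hM01]; push_cast; rfl) (by rw [hM10]; push_cast; rfl)
      (by rw [hM11]; push_cast; rfl)
  have hM' : ∀ x y, slopeDist (M⁻¹ • x) (M⁻¹ • y) = slopeDist x y := by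
    intro x y
    rw [← hM, smul_inv_smul, smul_inv_smul]
  have hMx : ∀ x : ℚ, M • (x : Slope) = if (p₁ + p₂) * (x - r) = 0 then ∞ else
      ((p₁ * (x - rOne l n) / ((p₁ + p₂) * (x - r)) : ℚ) : Slope) := by
    intro x
    rw [OnePoint.smul_some_eq_ite, hM00, hM01, hM10, hM11]
    rw [show (p₁ + p₂) * x + -(q₁ + q₂) = (p₁ + p₂) * (x - r) by linear_combination hrp,
      show p₁ * x + -q₁ = p₁ * (x - rOne l n) by linear_combination hr₁p]
  have hMr : M • (r : Slope) = ∞ := by rw [hMx, if_pos (by ring)]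
  have hMinf : M • (∞ : Slope) = ((p₁ / (p₁ + p₂) : ℚ) : Slope) := by
    rw [OnePoint.smul_infty_eq_ite, hM00, hM10, if_neg (by positivity)]
  have hMr' : M⁻¹ • (∞ : Slope) = r := by rw [← hMr, inv_smul_smul]
  have hGam : ∀ g ∈ Gam (r : Slope), M * g * M⁻¹ ∈ Gam ∞ := fun g hg =>
    hMr ▸ conj_mem_Gam hM hg
  have hGam' : ∀ g ∈ Gam ∞, M⁻¹ * g * M ∈ Gam (r : Slope) := fun g hg => by
    have := conj_mem_Gam hM' hg
    rwa [hMr', inv_inv] at this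
  set N : Slope → Slope := fun x => M⁻¹ • foldSlope (M • x) with hN
  have hNfix : ∀ x, N x = x ↔ foldSlope (M • x) = M • x := fun x => inv_smul_eq_iff
  have hNcoe : ∀ x : ℚ, N x = x ↔ x = r ∨ x ≤ rOne l n ∨ rTwo l n ≤ x := by
    intro x
    rw [hNfix, foldSlope_eq_self_iff, hMx]
    have hpp : (p₁ : ℚ) + p₂ ≠ 0 := by positivity
    by_cases hxr : x = r
    · simp [hxr]
    · have hxr' : x - r ≠ 0 := sub_ne_zero.2 hxr
      have hne : ((p₁ : ℚ) + p₂) * (x - r) ≠ 0 := mul_ne_zero hpp hxr'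
      simp only [hne, if_false, OnePoint.coe_ne_infty, false_or, OnePoint.coe_eq_coe,
        exists_eq_left', hxr]
      have hsub : p₁ * (x - rOne l n) - (p₁ + p₂) * (x - r) = -(p₂ * (x - rTwo l n)) := by
        linear_combination hrp - hr₁p - hr₂p
      rcases lt_or_gt_of_ne hxr with hlt | hgt
      · have hneg : ((p₁ : ℚ) + p₂) * (x - r) < 0 :=
          mul_neg_of_pos_of_neg (by positivity) (by linarith)
        rw [div_le_one_of_neg hneg, ← neg_div_neg_eq, le_div_iff₀ (by linarith)]
        constructor
        · rintro ⟨h, -⟩; left; nlinarith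
        · rintro (h | h)
          · constructor <;> nlinarith
          · linarith
      · have hpos : 0 < ((p₁ : ℚ) + p₂) * (x - r) := mul_pos (by positivity) (by linarith)
        rw [div_le_one hpos, le_div_iff₀ hpos]
        constructor
        · rintro ⟨-, h⟩; right; nlinarith
        · rintro (h | h)
          · linarith
          · constructor <;> nlinarith
  have hfund : ∀ x : Slope, x ∈ fundSet l n ↔ foldSlope x = x ∧ N x = x := by
    intro x
    induction x using OnePoint.rec with
    | infty =>
      have : N ∞ = ∞ := by
        rw [hNfix, hMinf, foldSlope_coe, OnePoint.coe_eq_coe, fold_eq_self_iff]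
        exact ⟨by positivity, by rw [div_le_one (by positivity)]; linarith⟩
      simp [fundSet, this]
    | coe x =>
      rw [hNcoe, foldSlope_coe, OnePoint.coe_eq_coe, fold_eq_self_iff]
      simp only [fundSet, ← hr, Set.mem_union, Set.mem_image, Set.mem_Icc, OnePoint.coe_eq_coe,
        exists_eq_right, Set.mem_insert_iff, OnePoint.coe_ne_infty, false_or,
        Set.mem_singleton_iff]
      constructor
      · rintro ((⟨h, h'⟩ | ⟨h, h'⟩) | rfl)
        · exact ⟨⟨h, by linarith⟩, Or.inr (Or.inl h')⟩
        · exact ⟨⟨by linarith, h'⟩, Or.inr (Or.inr h)⟩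
        · exact ⟨⟨hr0.le, hr1.le⟩, Or.inl rfl⟩
      · rintro ⟨⟨h, h'⟩, h1 | h1 | h1⟩
        · exact Or.inr h1
        · exact Or.inl (Or.inl ⟨h, h1⟩)
        · exact Or.inl (Or.inr ⟨h1, h'⟩)
  simp only [hfund]
  rw [GamHat, sup_comm]
  have lift : ∀ {x y : Slope}, slopeDist x ∞ + slopeDist x r < slopeDist y ∞ + slopeDist y r →
      (slopeDist x ∞ + slopeDist x r).toNat < (slopeDist y ∞ + slopeDist y r).toNat := by
    intro x y h
    have h1 := slopeDist_nonneg x ∞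
    have h2 := slopeDist_nonneg x r
    omega
  refine existsUnique_fixed_of_folds (Gam ∞) (Gam (r : Slope)) foldSlope N
    (fun x => (slopeDist x ∞ + slopeDist x r).toNat) (fun g hg x => foldSlope_smul hg x) ?_
    exists_smul_eq_foldSlope ?_ ?_ ?_ ?_ s
  · intro g hg x
    have h : M • g • x = (M * g * M⁻¹) • M • x := by simp [mul_smul]
    simp only [hN]
    rw [h, foldSlope_smul (hGam g hg)]
  · intro x
    obtain ⟨g, hg, hgx⟩ := exists_smul_eq_foldSlope (M • x)
    exact ⟨_, hGam' g hg, by simp only [hN, ← hgx, mul_smul]⟩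
  · intro x
    induction x using OnePoint.rec with
    | infty => exact Or.inl rfl
    | coe x =>
      rw [hNcoe, foldSlope_coe, OnePoint.coe_eq_coe, fold_eq_self_iff]
      by_cases h1 : x ≤ rOne l n
      · tauto
      · by_cases h2 : rTwo l n ≤ x
        · tauto
        · push Not at h1 h2
          left; constructor <;> linarith
  · exact fun x hx => lift (slopeDist_foldSlope_lt hx hr0 hr1)
  · intro x hx
    refine lift ?_
    have h := slopeDist_foldSlope_lt (s := M • x) (fun h => hx ((hNfix x).2 h))
      (q := p₁ / (p₁ + p₂)) (by positivity) (by rw [div_lt_one (by positivity)]; linarith)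
    have h1 : slopeDist (N x) ∞ = slopeDist (foldSlope (M • x)) (p₁ / (p₁ + p₂) : ℚ) := by
      rw [← hM, hMinf]; simp only [hN, smul_inv_smul]
    have h2 : slopeDist (N x) r = slopeDist (foldSlope (M • x)) ∞ := by
      rw [← hM, hMr]; simp only [hN, smul_inv_smul]
    have h3 : slopeDist x ∞ = slopeDist (M • x) (p₁ / (p₁ + p₂) : ℚ) := by
      rw [← hM, hMinf]
    have h4 : slopeDist x r = slopeDist (M • x) ∞ := by
      rw [← hM, hMr]
    linarith

/-! ### The Conway sphere and its marked points -/

/-- The elements of `H` are the translations by `2 ℤ²` and the rotations by `π` about `ℤ²`. -/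
theorem conwayGroup_apply {g : Equiv.Perm (ℝ × ℝ)} (hg : g ∈ conwayGroup) :
    ∃ w : ℤ × ℤ, (∀ v, g v = (2 : ℝ) • latticePoint w + v) ∨
      ∀ v, g v = (2 : ℝ) • latticePoint w - v := by
  induction hg using Subgroup.closure_induction with
  | mem g hg =>
    obtain ⟨w, rfl⟩ := hg
    refine ⟨w, Or.inr fun v => ?_⟩
    simp [Equiv.pointReflection_apply, two_smul]
    abel
  | one => exact ⟨0, Or.inl fun v => by ext <;> simp [latticePoint]⟩
  | mul g h _ _ ihg ihh =>
    obtain ⟨w, hw⟩ := ihg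
    obtain ⟨z, hz⟩ := ihh
    rcases hw with hw | hw <;> rcases hz with hz | hz
    · refine ⟨w + z, Or.inl fun v => ?_⟩
      rw [Equiv.Perm.mul_apply, hz, hw]
      ext <;> simp [latticePoint] <;> ring
    · refine ⟨w + z, Or.inr fun v => ?_⟩
      rw [Equiv.Perm.mul_apply, hz, hw]
      ext <;> simp [latticePoint] <;> ring
    · refine ⟨w - z, Or.inr fun v => ?_⟩
      rw [Equiv.Perm.mul_apply, hz, hw]
      ext <;> simp [latticePoint] <;> ring
    · refine ⟨w - z, Or.inl fun v => ?_⟩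
      rw [Equiv.Perm.mul_apply, hz, hw]
      ext <;> simp [latticePoint] <;> ring
  | inv g _ ih =>
    obtain ⟨w, hw | hw⟩ := ih
    · refine ⟨-w, Or.inl fun v => ?_⟩
      rw [Equiv.Perm.inv_eq_iff_eq, hw]
      ext <;> simp [latticePoint]
    · refine ⟨w, Or.inr fun v => ?_⟩
      rw [Equiv.Perm.inv_eq_iff_eq, hw]
      ext <;> simp [latticePoint]

theorem exists_of_proj_eq {v v' : ℝ × ℝ} (h : proj v = proj v') :
    ∃ w : ℤ × ℤ, v = (2 : ℝ) • latticePoint w + v' ∨ v = (2 : ℝ) • latticePoint w - v' := by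
  obtain ⟨⟨g, hg⟩, hgv⟩ := Quotient.exact (s := MulAction.orbitRel conwayGroup (ℝ × ℝ)) h
  change g v' = v at hgv
  obtain ⟨w, hw | hw⟩ := conwayGroup_apply hg
  · exact ⟨w, Or.inl (by rw [← hgv, hw])⟩
  · exact ⟨w, Or.inr (by rw [← hgv, hw])⟩

theorem proj_neg (v : ℝ × ℝ) : proj (-v) = proj v := by
  refine Quotient.sound (s := MulAction.orbitRel conwayGroup (ℝ × ℝ)) ?_
  refine ⟨⟨Equiv.pointReflection (latticePoint 0), Subgroup.subset_closure ⟨0, rfl⟩⟩, ?_⟩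
  ext <;> simp [Subgroup.smul_def, Equiv.pointReflection_apply, latticePoint]

theorem proj_mem_punctures {v : ℝ × ℝ} : proj v ∈ punctures ↔ v ∈ lattice := by
  refine ⟨?_, fun h => ⟨v, h, rfl⟩⟩
  rintro ⟨_, ⟨u, rfl⟩, h⟩
  obtain ⟨w, hw | hw⟩ := exists_of_proj_eq h.symm
  · refine ⟨2 * w + u, ?_⟩
    rw [hw]; ext <;> simp [latticePoint]
  · refine ⟨2 * w - u, ?_⟩
    rw [hw]; ext <;> simp [latticePoint]

/-- The determinant of a vector of the plane and the direction of slope `s`. Up to scale this is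
the coordinate that is constant on the lines of slope `s`. -/
def leafCoord (s : Slope) (v : ℝ × ℝ) : ℝ := v.1 * (slopeVec s).2 - v.2 * (slopeVec s).1

theorem leafCoord_add_smul (s : Slope) (v : ℝ × ℝ) (t : ℝ) :
    leafCoord s (v + t • dir s) = leafCoord s v := by
  simp [leafCoord, dir, latticePoint]; ring

theorem leafCoord_int_of_proj_eq {s : Slope} {v v' : ℝ × ℝ} (h : proj v = proj v')
    (hv' : ∃ n : ℤ, leafCoord s v' = n) : ∃ n : ℤ, leafCoord s v = n := by
  obtain ⟨n, hn⟩ := hv'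
  obtain ⟨w, hw | hw⟩ := exists_of_proj_eq h
  · refine ⟨2 * (w.1 * (slopeVec s).2 - w.2 * (slopeVec s).1) + n, ?_⟩
    push_cast
    rw [← hn, hw]
    simp [leafCoord, latticePoint]; ring
  · refine ⟨2 * (w.1 * (slopeVec s).2 - w.2 * (slopeVec s).1) - n, ?_⟩
    push_cast
    rw [← hn, hw]
    simp [leafCoord, latticePoint]; ring

/-! ### The strands of a tangle, and the link -/

/-- At the inner end the strands are exceptional leaves; elsewhere they lie over marked points. -/
theorem of_mem_strands {s : Slope} {v : ℝ × ℝ} {c : I}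
    (h : (Quot.mk (TangleRel s) (proj v, c) : TangleBall s) ∈ strands s) :
    (∃ n : ℤ, leafCoord s v = n) ∧ (c ≠ 1 → v ∈ lattice) := by
  -- the condition descends to the quotient
  let Q : TangleBall s → Prop := Quot.lift
    (fun z => (∃ u, proj u = z.1 ∧ ∃ n : ℤ, leafCoord s u = n) ∧ (z.2 ≠ 1 → z.1 ∈ punctures))
    (by
      rintro ⟨x, a⟩ ⟨y, b⟩ ⟨ha, hb, u, t, hx, hy⟩
      dsimp only at ha hb hx hy
      subst ha hb hx hy
      simp only [ne_eq, not_true_eq_false, false_imp_iff, and_true, eq_iff_iff]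
      constructor
      · rintro ⟨u', h1, h2⟩
        refine ⟨u + t • dir s, rfl, ?_⟩
        rw [leafCoord_add_smul]
        exact leafCoord_int_of_proj_eq h1.symm h2
      · rintro ⟨u', h1, h2⟩
        refine ⟨u, rfl, ?_⟩
        rw [← leafCoord_add_smul s u t]
        exact leafCoord_int_of_proj_eq h1.symm h2)
  have hQ : ∀ z ∈ strands s, Q z := by
    rintro _ ⟨⟨x, a⟩, ⟨hx, -⟩, rfl⟩
    obtain ⟨_, ⟨w, rfl⟩, rfl⟩ := hx
    refine ⟨⟨_, rfl, w.1 * (slopeVec s).2 - w.2 * (slopeVec s).1, ?_⟩, fun _ => ⟨_, ⟨w, rfl⟩, rfl⟩⟩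
    simp [leafCoord, latticePoint]
  obtain ⟨⟨u, h1, h2⟩, h3⟩ := hQ _ h
  exact ⟨leafCoord_int_of_proj_eq h1.symm h2, fun hc => proj_mem_punctures.1 (h3 hc)⟩

theorem bdry_mem_strands {s : Slope} {x : ConwaySphere} : bdry s x ∈ strands s ↔ x ∈ punctures := by
  refine ⟨fun h => ?_, fun h => ⟨(x, 0), ⟨h, trivial⟩, rfl⟩⟩
  induction x using Quotient.inductionOn with
  | h v => exact proj_mem_punctures.2 ((of_mem_strands (v := v) h).2 zero_ne_one)

theorem mem_link_iff {r : Slope} {z : TangleBall ∞ ⊕ TangleBall r} :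
    (Quot.mk (GlueRel r) z : LinkSphere r) ∈ link r ↔
      Sum.elim (· ∈ strands ∞) (· ∈ strands r) z := by
  let Q : LinkSphere r → Prop := Quot.lift (Sum.elim (· ∈ strands ∞) (· ∈ strands r)) (by
    rintro _ _ ⟨x⟩
    simp only [Sum.elim_inl, Sum.elim_inr, bdry_mem_strands])
  constructor
  · intro h
    suffices hQ : ∀ y ∈ link r, Q y from hQ _ h
    rintro _ (⟨y, hy, rfl⟩ | ⟨y, hy, rfl⟩) <;> exact hy
  · intro h
    rcases z with z | z
    · exact Or.inl ⟨z, h, rfl⟩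
    · exact Or.inr ⟨z, h, rfl⟩

theorem bridgeSphere_mem_link {r : Slope} {v : ℝ × ℝ} :
    bridgeSphere r (proj v) ∈ link r ↔ v ∈ lattice := by
  change (Quot.mk (GlueRel r) _ : LinkSphere r) ∈ link r ↔ _
  rw [mem_link_iff, Sum.elim_inl, bdry_mem_strands, proj_mem_punctures]

theorem bridgeSphere_eq_inr (r : Slope) (x : ConwaySphere) :
    bridgeSphere r x = Quot.mk (GlueRel r) (Sum.inr (bdry r x)) :=
  Quot.sound (GlueRel.glue x)

/-! ### Free homotopy of loops -/

theorem FreelyHomotopicInComplement.comp_neg {r : Slope} {γ γ' : C(UnitAddCircle, LinkSphere r)}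
    (h : FreelyHomotopicInComplement r γ γ') :
    FreelyHomotopicInComplement r (γ.comp ⟨fun x => -x, continuous_neg⟩)
      (γ'.comp ⟨fun x => -x, continuous_neg⟩) := by
  obtain ⟨H⟩ := h
  exact ⟨{ toFun := fun p => H (p.1, -p.2)
           continuous_toFun := H.continuous.comp (by fun_prop)
           map_zero_left := fun x => H.apply_zero (-x)
           map_one_left := fun x => H.apply_one (-x)
           prop' := fun t x => H.prop' t (-x) }⟩

theorem comp_neg_comp_neg {Y : Type*} [TopologicalSpace Y] (γ : C(UnitAddCircle, Y)) :
    (γ.comp ⟨fun x => -x, continuous_neg⟩).comp ⟨fun x => -x, continuous_neg⟩ = γ := by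
  ext x; simp

theorem UnorientedHomotopicInComplement.symm {r : Slope} {γ γ' : C(UnitAddCircle, LinkSphere r)}
    (h : UnorientedHomotopicInComplement r γ γ') : UnorientedHomotopicInComplement r γ' γ := by
  rcases h with h | h
  · exact Or.inl (ContinuousMap.HomotopicWith.symm h)
  · refine Or.inr (ContinuousMap.HomotopicWith.symm ?_)
    have := h.comp_neg
    rwa [comp_neg_comp_neg] at this

theorem UnorientedHomotopicInComplement.trans {r : Slope}
    {γ γ' γ'' : C(UnitAddCircle, LinkSphere r)}
    (h : UnorientedHomotopicInComplement r γ γ') (h' : UnorientedHomotopicInComplement r γ' γ'') :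
    UnorientedHomotopicInComplement r γ γ'' := by
  rcases h with h | h <;> rcases h' with h' | h'
  · exact Or.inl (ContinuousMap.HomotopicWith.trans h h')
  · exact Or.inr (ContinuousMap.HomotopicWith.trans h h')
  · exact Or.inr (ContinuousMap.HomotopicWith.trans h h'.comp_neg)
  · refine Or.inl (ContinuousMap.HomotopicWith.trans h ?_)
    have := h'.comp_neg
    rwa [comp_neg_comp_neg] at this

/-- A homotopy of loops, given as a homotopy of periodic functions on the line. -/
theorem freelyHomotopic_of_periodic {r : Slope} {γ γ' : C(UnitAddCircle, LinkSphere r)}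
    (F : ℝ × ℝ → LinkSphere r) (hF : Continuous F) (hper : ∀ u t, F (u, t + 1) = F (u, t))
    (h0 : ∀ t : ℝ, γ (t : UnitAddCircle) = F (0, t))
    (h1 : ∀ t : ℝ, γ' (t : UnitAddCircle) = F (1, t))
    (hl : ∀ u t, 0 ≤ u → u ≤ 1 → F (u, t) ∉ link r) : FreelyHomotopicInComplement r γ γ' := by
  have hq : IsOpenQuotientMap (Prod.map (id : I → I) ((↑) : ℝ → UnitAddCircle)) :=
    IsOpenQuotientMap.prodMap IsOpenQuotientMap.id QuotientAddGroup.isOpenQuotientMap_mk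
  let G : I × UnitAddCircle → LinkSphere r := fun p =>
    Function.Periodic.lift (f := fun t : ℝ => F (p.1, t)) (c := 1) (fun t => hper _ t) p.2
  have hG : ∀ (u : I) (t : ℝ), G (u, (t : UnitAddCircle)) = F (u, t) := fun _ _ => rfl
  have hGc : Continuous G := by
    rw [← hq.continuous_comp_iff]
    exact hF.comp (by fun_prop : Continuous fun p : I × ℝ => ((p.1 : ℝ), p.2))
  refine ⟨{ toFun := G
            continuous_toFun := hGc
            map_zero_left := fun x => ?_
            map_one_left := fun x => ?_
            prop' := fun u x => ?_ }⟩
  · induction x using QuotientAddGroup.induction_on with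
    | H t => exact (h0 t).symm
  · induction x using QuotientAddGroup.induction_on with
    | H t => exact (h1 t).symm
  · induction x using QuotientAddGroup.induction_on with
    | H t => exact hl u t u.2.1 u.2.2

theorem slopeLoop_coe (s : Slope) (b : ℝ × ℝ) (t : ℝ) :
    slopeLoop s b (t : UnitAddCircle) = proj (b + (2 * t) • dir s) := rfl

/-! ### Coordinates from a Farey edge -/

theorem exists_isFareyEdge (s : Slope) : ∃ y : Slope, IsFareyEdge s y := by
  obtain ⟨u, v, huv⟩ := isCoprime_slopeVec s
  have hco : IsCoprime (-v) u := ⟨-(slopeVec s).2, (slopeVec s).1, by linear_combination huv⟩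
  refine ⟨toSlope (-v : ℤ) u, ?_⟩
  unfold IsFareyEdge
  rcases slopeVec_toSlope hco with h | h
  · rw [h]; dsimp only
    rw [show (slopeVec s).1 * u - (slopeVec s).2 * -v = 1 by linear_combination huv]; rfl
  · rw [h]; dsimp only
    rw [show (slopeVec s).1 * -u - (slopeVec s).2 * - -v = -1 by linear_combination -huv]; rfl

theorem IsFareyEdge.sq_eq_one {c y : Slope} (h : IsFareyEdge c y) :
    (((slopeVec c).1 : ℝ) * (slopeVec y).2 - (slopeVec c).2 * (slopeVec y).1) ^ 2 = 1 := by
  have : ((slopeVec c).1 * (slopeVec y).2 - (slopeVec c).2 * (slopeVec y).1) ^ 2 = 1 := by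
    rw [← sq_abs, h]; rfl
  exact_mod_cast this

theorem IsFareyEdge.exists_eq {c y : Slope} (h : IsFareyEdge c y) (v : ℝ × ℝ) :
    ∃ x z : ℝ, v = x • dir y + z • dir c := by
  have h2 := h.sq_eq_one
  set D : ℝ := ((slopeVec c).1 : ℝ) * (slopeVec y).2 - (slopeVec c).2 * (slopeVec y).1 with hD
  refine ⟨D * ((slopeVec c).1 * v.2 - (slopeVec c).2 * v.1),
    D * (v.1 * (slopeVec y).2 - v.2 * (slopeVec y).1), ?_⟩
  ext
  · simp only [dir, latticePoint, Prod.fst_add, Prod.smul_fst, smul_eq_mul]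
    linear_combination (-v.1) * h2 + D * v.1 * hD
  · simp only [dir, latticePoint, Prod.snd_add, Prod.smul_snd, smul_eq_mul]
    linear_combination (-v.2) * h2 + D * v.2 * hD

theorem IsFareyEdge.int_of_leafCoord {c y : Slope} (h : IsFareyEdge c y) {x z : ℝ}
    (hx : ∃ n : ℤ, leafCoord c (x • dir y + z • dir c) = n) : ∃ n : ℤ, x = n := by
  obtain ⟨n, hn⟩ := hx
  have h2 := h.sq_eq_one
  refine ⟨-((slopeVec c).1 * (slopeVec y).2 - (slopeVec c).2 * (slopeVec y).1) * n, ?_⟩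
  push_cast
  rw [← hn]
  simp only [leafCoord, dir, latticePoint, Prod.fst_add, Prod.smul_fst, Prod.snd_add,
    Prod.smul_snd, smul_eq_mul]
  linear_combination (-x) * h2

theorem IsFareyEdge.symm {c y : Slope} (h : IsFareyEdge c y) : IsFareyEdge y c := by
  rw [isFareyEdge_iff, slopeDist_comm]; exact h

theorem leafCoord_of_mem_lattice (s : Slope) {v : ℝ × ℝ} (h : v ∈ lattice) :
    ∃ n : ℤ, leafCoord s v = n := by
  obtain ⟨w, rfl⟩ := h
  exact ⟨w.1 * (slopeVec s).2 - w.2 * (slopeVec s).1, by simp [leafCoord, latticePoint]⟩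

theorem IsFareyEdge.int_of_mem_lattice {c y : Slope} (h : IsFareyEdge c y) {x z : ℝ}
    (hx : x • dir y + z • dir c ∈ lattice) : (∃ n : ℤ, x = n) ∧ ∃ n : ℤ, z = n := by
  refine ⟨h.int_of_leafCoord (leafCoord_of_mem_lattice c hx), ?_⟩
  rw [add_comm] at hx
  exact h.symm.int_of_leafCoord (leafCoord_of_mem_lattice y hx)

theorem dir_eq_of_comb {s c y : Slope} {a b : ℤ}
    (h : slopeVec s = a • slopeVec c + b • slopeVec y) :
    dir s = (b : ℝ) • dir y + (a : ℝ) • dir c := by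
  rw [dir, h]
  ext <;> simp [dir, latticePoint] <;> ring

/-! ### Lines of the same slope -/

/-- In coordinates in which the lines of slope `s` are vertical, a line that misses the lattice
can be moved inside its strip to the middle of the strip. -/
theorem exists_standard_loop (r s : Slope) : ∃ b₀ : ℝ × ℝ, LineAvoidsLattice s b₀ ∧
    ∀ b, LineAvoidsLattice s b → UnorientedHomotopicInComplement r
      ((bridgeSphere r).comp (slopeLoop s b)) ((bridgeSphere r).comp (slopeLoop s b₀)) := by
  obtain ⟨y, hy⟩ := exists_isFareyEdge s
  refine ⟨(1 / 2 : ℝ) • dir y, ?_, ?_⟩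
  · intro t ht
    obtain ⟨⟨n, hn⟩, -⟩ := hy.int_of_mem_lattice ht
    have h2 : ((2 * n : ℤ) : ℝ) = (1 : ℤ) := by push_cast; rw [← hn]; norm_num
    have h3 : 2 * n = 1 := by exact_mod_cast h2
    omega
  · intro b hb
    obtain ⟨x, z, rfl⟩ := hy.exists_eq b
    have hx : ∀ n : ℤ, x ≠ n := by
      rintro n rfl
      refine hb (-z) ⟨n • slopeVec y, ?_⟩
      ext <;> simp [dir, latticePoint]
    set m := ⌊x⌋ with hm
    have hm1 : (m : ℝ) < x := lt_of_le_of_ne (Int.floor_le x) (hx m).symm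
    have hm2 : x < m + 1 := Int.lt_floor_add_one x
    let F : ℝ × ℝ → LinkSphere r := fun p => bridgeSphere r (proj
      (((1 - p.1) * x + p.1 * (m + 1 / 2)) • dir y + ((1 - p.1) * z + 2 * p.2) • dir s))
    have hF : Continuous F := (bridgeSphere r).continuous.comp (continuous_proj.comp (by fun_prop))
    have hper : ∀ u t, F (u, t + 1) = F (u, t) := by
      intro u t
      refine congrArg (bridgeSphere r) (Eq.trans ?_ (proj_add_two_mul _ (slopeVec s)))
      congr 1
      rw [← dir]
      module
    have hav : ∀ u t, 0 ≤ u → u ≤ 1 → F (u, t) ∉ link r := by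
      intro u t h0 h1 hmem
      obtain ⟨⟨n, hn⟩, -⟩ := hy.int_of_mem_lattice (bridgeSphere_mem_link.1 hmem)
      dsimp only at hn
      have hn1 : (m : ℝ) < n := by nlinarith
      have hn2 : (n : ℝ) < m + 1 := by nlinarith
      have hn1' : m < n := by exact_mod_cast hn1
      have hn2' : n < m + 1 := by exact_mod_cast hn2
      omega
    have h0 : ∀ t : ℝ, ((bridgeSphere r).comp (slopeLoop s (x • dir y + z • dir s)))
        (t : UnitAddCircle) = F (0, t) := by
      intro t
      rw [ContinuousMap.comp_apply, slopeLoop_coe]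
      simp only [F]
      congr 2
      module
    rcases Int.even_or_odd m with ⟨k, hk⟩ | ⟨k, hk⟩
    · refine Or.inl (freelyHomotopic_of_periodic F hF hper h0 (fun t => ?_) hav)
      rw [ContinuousMap.comp_apply, slopeLoop_coe]
      simp only [F]
      rw [← proj_add_two_mul _ (k • slopeVec y)]
      congr 2
      have : latticePoint (k • slopeVec y) = (k : ℝ) • dir y := by
        ext <;> simp [dir, latticePoint]
      rw [this, hk]
      push_cast
      module
    · -- a rotation by `π` takes an odd strip to the standard one and reverses its lines
      refine Or.inr (freelyHomotopic_of_periodic F hF hper h0 (fun t => ?_) hav)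
      change bridgeSphere r (slopeLoop s _ (-(t : UnitAddCircle))) = _
      rw [← AddCircle.coe_neg, slopeLoop_coe]
      simp only [F]
      rw [← proj_neg, ← proj_add_two_mul _ ((k + 1) • slopeVec y)]
      congr 2
      have : latticePoint ((k + 1) • slopeVec y) = ((k : ℝ) + 1) • dir y := by
        ext <;> simp [dir, latticePoint]
      rw [this, hk]
      push_cast
      module

theorem AlphaHomotopic.of_pair {r s s' : Slope} {b b' : ℝ × ℝ} (hb : LineAvoidsLattice s b)
    (hb' : LineAvoidsLattice s' b') (h : UnorientedHomotopicInComplement r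
      ((bridgeSphere r).comp (slopeLoop s b)) ((bridgeSphere r).comp (slopeLoop s' b'))) :
    AlphaHomotopic r s s' := by
  obtain ⟨b₀, -, hs⟩ := exists_standard_loop r s
  obtain ⟨b₀', -, hs'⟩ := exists_standard_loop r s'
  intro c c' hc hc'
  exact (hs c hc).trans (((hs b hb).symm.trans (h.trans (hs' b' hb'))).trans (hs' c' hc').symm)

/-- The equivalence relation on slopes given by homotopy of their loops. -/
def alphaSetoid (r : Slope) : Setoid Slope where
  r := AlphaHomotopic r
  iseqv :=
    { refl := fun s b b' hb hb' => by
        obtain ⟨b₀, -, hs⟩ := exists_standard_loop r s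
        exact (hs b hb).trans (hs b' hb').symm
      symm := fun h b b' hb hb' => (h b' b hb' hb).symm
      trans := fun {s s' s''} h h' b b'' hb hb'' => by
        obtain ⟨b₀, hb₀, -⟩ := exists_standard_loop r s'
        exact (h b b₀ hb hb₀).trans (h' b₀ b'' hb₀ hb'') }

/-! ### Interpolating a sequence by a locally constant function near the integers -/

/-- A function on the integers extends to a continuous function on the line that is constant near
each integer and inherits quasi-periodicity. -/
theorem exists_continuous_step (a : ℤ → ℝ) : ∃ J : ℝ → ℝ, Continuous J ∧
    (∀ (n : ℤ) (x : ℝ), |x - n| ≤ 1 / 4 → J x = a n) ∧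
    ∀ (p : ℤ) (c : ℝ), (∀ n, a (n + p) = a n + c) → ∀ x, J (x + p) = J x + c := by
  let φ : ℝ → ℝ := fun z => max 0 (min 1 (2 * z - 1 / 2))
  have hφ : Continuous φ := by fun_prop
  have hφ0 : ∀ z, z ≤ 1 / 4 → φ z = 0 := fun z hz =>
    max_eq_left ((min_le_right _ _).trans (by linarith))
  have hφ1 : ∀ z, 3 / 4 ≤ z → φ z = 1 := fun z hz => by
    simp only [φ]
    rw [min_eq_left (by linarith)]
    norm_num
  let J : ℝ → ℝ := fun x => a ⌊x⌋ + φ (x - ⌊x⌋) * (a (⌊x⌋ + 1) - a ⌊x⌋)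
  have hfl : ∀ (n : ℤ) (x : ℝ), (n : ℝ) ≤ x → x < n + 1 →
      J x = a n + φ (x - n) * (a (n + 1) - a n) := by
    intro n x h0 h1
    simp only [J, Int.floor_eq_iff.2 ⟨h0, h1⟩]
  have hnear : ∀ (n : ℤ) (x : ℝ), |x - n| ≤ 1 / 4 → J x = a n := by
    intro n x h
    rw [abs_le] at h
    rcases le_or_gt (n : ℝ) x with hx | hx
    · rw [hfl n x hx (by linarith), hφ0 _ (by linarith)]; ring
    · rw [hfl (n - 1) x (by push_cast; linarith) (by push_cast; linarith),
        hφ1 _ (by push_cast; linarith), sub_add_cancel]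
      ring
  refine ⟨J, ?_, hnear, ?_⟩
  · have hlf : LocallyFinite fun n : ℤ => Set.Icc (n : ℝ) (n + 1) :=
      locallyFinite_Icc_of_tendsto tendsto_intCast_atTop_atTop
        (Filter.tendsto_atBot_add_const_right _ _ (tendsto_intCast_atBot_iff.2 Filter.tendsto_id))
    refine hlf.continuous ?_ (fun n => isClosed_Icc) fun n => ?_
    · exact Set.iUnion_eq_univ_iff.2 fun x => ⟨⌊x⌋, Int.floor_le x, (Int.lt_floor_add_one x).le⟩
    · have hc : Continuous fun x : ℝ => a n + φ (x - n) * (a (n + 1) - a n) := by fun_prop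
      refine hc.continuousOn.congr fun x hx => ?_
      rcases hx.2.lt_or_eq with h | h
      · exact hfl n x hx.1 h
      · dsimp only
        rw [hnear (n + 1) x (by rw [h]; push_cast; norm_num), hφ1 _ (by rw [h]; norm_num)]
        ring
  · intro p c hp x
    have hn : a (⌊x⌋ + p + 1) = a (⌊x⌋ + 1) + c := by rw [← hp]; congr 1; ring
    simp only [J, Int.floor_add_intCast, hp, hn]
    push_cast
    rw [add_sub_add_right_eq_sub]
    ring

/-! ### Homotopies through the mapping cylinder -/

/-- The point of the tangle ball of slope `c` with plane coordinates `(x, z)` in the basis formed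
by the directions of `y` and `c`, at the level `h` (clamped to `[0, 1]`) of the mapping
cylinder. -/
def tanglePoint (c y : Slope) (x z h : ℝ) : TangleBall c :=
  Quot.mk (TangleRel c) (proj (x • dir y + z • dir c), Set.projIcc 0 1 zero_le_one h)

theorem continuous_tanglePoint (c y : Slope) :
    Continuous fun p : ℝ × ℝ × ℝ => tanglePoint c y p.1 p.2.1 p.2.2 :=
  continuous_quot_mk.comp ((continuous_proj.comp (by fun_prop)).prodMk
    (continuous_projIcc.comp (by fun_prop)))

theorem tanglePoint_zero (c y : Slope) (x z : ℝ) :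
    tanglePoint c y x z 0 = bdry c (proj (x • dir y + z • dir c)) := by
  rw [tanglePoint, Set.projIcc_left]; rfl

theorem tanglePoint_add (c y : Slope) (x z h : ℝ) (m n : ℤ) :
    tanglePoint c y (x + 2 * m) (z + 2 * n) h = tanglePoint c y x z h := by
  rw [tanglePoint, tanglePoint, ← proj_add_two_mul (x • dir y + z • dir c)
    (m • slopeVec y + n • slopeVec c)]
  congr 3
  ext <;> simp [dir, latticePoint] <;> ring

theorem tanglePoint_inner (c y : Slope) (x z z' : ℝ) {h : ℝ} (hh : 1 ≤ h) :
    tanglePoint c y x z h = tanglePoint c y x z' h := by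
  rw [tanglePoint, tanglePoint, Set.projIcc_of_right_le _ hh]
  refine Quot.sound ⟨rfl, rfl, x • dir y + z • dir c, z' - z, rfl, ?_⟩
  congr 1
  module

theorem of_tanglePoint_mem_strands {c y : Slope} (hy : IsFareyEdge c y) {x z h : ℝ}
    (hm : tanglePoint c y x z h ∈ strands c) :
    (∃ n : ℤ, x = n) ∧ (h < 1 → ∃ n : ℤ, z = n) := by
  obtain ⟨h1, h2⟩ := of_mem_strands hm
  refine ⟨hy.int_of_leafCoord h1, fun hh => (hy.int_of_mem_lattice (h2 ?_)).2⟩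
  rw [ne_eq, projIcc_eq_one]
  exact hh.not_ge

/-- A level function on the strips: `0` over the integers and at least `1` away from them. -/
def stripLevel (x : ℝ) : ℝ := 2 * Real.sin (Real.pi * x) ^ 2

theorem continuous_stripLevel : Continuous stripLevel := by
  unfold stripLevel; fun_prop

theorem stripLevel_add_int (x : ℝ) (n : ℤ) : stripLevel (x + n) = stripLevel x := by
  have h : Real.sin (Real.pi * (x + n)) = (-1) ^ n * Real.sin (Real.pi * x) := by
    rw [← Real.sin_add_int_mul_pi]; congr 1; ring
  rw [stripLevel, stripLevel, h, mul_pow, ← zpow_natCast, ← zpow_mul, mul_comm n, zpow_mul]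
  norm_num

theorem stripLevel_int (n : ℤ) : stripLevel n = 0 := by
  have := stripLevel_add_int 0 n
  rw [zero_add] at this
  rw [this]; simp [stripLevel]

theorem one_le_stripLevel {x : ℝ} (h : 1 / 4 ≤ |x - round x|) : 1 ≤ stripLevel x := by
  have h2 := abs_sub_round x
  have h3 : stripLevel x = stripLevel |x - round x| := by
    rw [← stripLevel_add_int x (-round x)]
    rcases abs_choice (x - round x) with e | e <;> rw [e] <;> simp [stripLevel, sub_eq_add_neg]
    rw [show Real.pi * (round x + -x) = -(Real.pi * (x + -round x)) by ring, Real.sin_neg, neg_sq]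
  rw [h3, stripLevel]
  have hpi := Real.pi_pos
  have h4 : Real.sin (Real.pi / 4) ≤ Real.sin (Real.pi * |x - round x|) :=
    Real.sin_le_sin_of_le_of_le_pi_div_two (by linarith) (by nlinarith) (by nlinarith)
  rw [Real.sin_pi_div_four] at h4
  have h5 : (0 : ℝ) < √2 / 2 := by positivity
  have h6 : (√2 / 2) ^ 2 = 1 / 2 := by rw [div_pow, Real.sq_sqrt (by norm_num)]; norm_num
  nlinarith

/-- The loop in the interior of the ball that runs above a line on the boundary, and that passes
each strip between two exceptional leaves at the inner end. -/
def raisedLoop {r : Slope} {c : Slope} (ι : C(TangleBall c, LinkSphere r)) (y : Slope) (m k : ℤ)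
    (z : ℝ) : C(UnitAddCircle, LinkSphere r) where
  toFun := Function.Periodic.lift (f := fun t : ℝ =>
    ι (tanglePoint c y (2 * m * t) (z + 2 * k * t) (stripLevel (2 * m * t)))) (c := 1) (by
      intro t
      have h1 := tanglePoint_add c y (2 * m * t) (z + 2 * k * t) (stripLevel (2 * m * t)) m k
      have h2 := stripLevel_add_int (2 * m * t) (2 * m)
      push_cast at h2
      dsimp only
      rw [← h1, ← h2]
      congr 2 <;> ring_nf)
  continuous_toFun := continuous_quot_lift _ (ι.continuous.comp
    ((continuous_tanglePoint c y).comp (by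
      have := continuous_stripLevel
      fun_prop : Continuous fun t : ℝ =>
        ((2 * m * t : ℝ), (z + 2 * k * t : ℝ), stripLevel (2 * m * t)))))

theorem raisedLoop_coe {r c : Slope} (ι : C(TangleBall c, LinkSphere r)) (y : Slope) (m k : ℤ)
    (z t : ℝ) : raisedLoop ι y m k z (t : UnitAddCircle) =
      ι (tanglePoint c y (2 * m * t) (z + 2 * k * t) (stripLevel (2 * m * t))) := rfl

theorem homotopic_raisedLoop {r c y : Slope} {ι : C(TangleBall c, LinkSphere r)}
    (hl : ∀ z, ι z ∈ link r → z ∈ strands c) (hy : IsFareyEdge c y) {m k : ℤ} {z : ℝ}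
    (hz : ∀ (t : ℝ) (n j : ℤ), 2 * m * t = n → z + 2 * k * t ≠ j)
    {γ : C(UnitAddCircle, LinkSphere r)}
    (hγ : ∀ t : ℝ, γ (t : UnitAddCircle) = ι (tanglePoint c y (2 * m * t) (z + 2 * k * t) 0)) :
    FreelyHomotopicInComplement r γ (raisedLoop ι y m k z) := by
  refine freelyHomotopic_of_periodic (fun p => ι (tanglePoint c y (2 * m * p.2)
    (z + 2 * k * p.2) (p.1 * stripLevel (2 * m * p.2)))) ?_ ?_ ?_ ?_ ?_
  · have := continuous_stripLevel
    exact ι.continuous.comp ((continuous_tanglePoint c y).comp (by fun_prop :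
      Continuous fun p : ℝ × ℝ => (2 * m * p.2, z + 2 * k * p.2, p.1 * stripLevel (2 * m * p.2))))
  · intro u t
    have h2 := stripLevel_add_int (2 * m * t) (2 * m)
    push_cast at h2
    dsimp only
    rw [← tanglePoint_add c y (2 * m * t) _ _ m k, ← h2]
    congr 2 <;> ring_nf
  · intro t; rw [hγ, zero_mul]
  · intro t; rw [raisedLoop_coe, one_mul]
  · intro u t h0 h1 hmem
    obtain ⟨⟨n, hn⟩, hj⟩ := of_tanglePoint_mem_strands hy (hl _ hmem)
    dsimp only at hn hj
    rw [hn, stripLevel_int, mul_zero] at hj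
    obtain ⟨j, hj⟩ := hj zero_lt_one
    exact hz t n j hn hj

/-- A line and its image under `z ↦ 1 - z` cross each exceptional leaf in the same segment between
marked points, up to the lattice `2 ℤ²`. Between these leaves the loop passes the inner end of the
cylinder, where the coordinate along the leaves does not matter. -/
theorem homotopic_raisedLoop_reflect {r c y : Slope} {ι : C(TangleBall c, LinkSphere r)}
    (hl : ∀ z, ι z ∈ link r → z ∈ strands c) (hy : IsFareyEdge c y) {m k : ℤ} (hm : m ≠ 0) {z : ℝ}
    (hz : ∀ (t : ℝ) (n j : ℤ), 2 * m * t = n → z + 2 * k * t ≠ j)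
    {γ : C(UnitAddCircle, LinkSphere r)}
    (hγ : ∀ t : ℝ, γ (t : UnitAddCircle) = ι (tanglePoint c y (2 * m * t) (z + 2 * k * t) 0)) :
    FreelyHomotopicInComplement r γ (raisedLoop ι y m (-k) (1 - z)) := by
  have hmr : (m : ℝ) ≠ 0 := by exact_mod_cast hm
  obtain ⟨J, hJc, hJn, hJp⟩ := exists_continuous_step fun n => (⌊z + k * n / m⌋ : ℝ)
  have hJper : ∀ t : ℝ, J (2 * m * (t + 1)) = J (2 * m * t) + 2 * k := by
    intro t
    have := hJp (2 * m) (2 * k) (fun n => ?_) (2 * m * t)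
    · rw [← this]; congr 1; push_cast; ring
    · have h : z + k * ((n + 2 * m : ℤ) : ℝ) / m = z + k * n / m + ((2 * k : ℤ) : ℝ) := by
        push_cast; field_simp; ring
      rw [h, Int.floor_add_intCast]
      push_cast; ring
  refine freelyHomotopic_of_periodic (fun p => ι (tanglePoint c y (2 * m * p.2)
    (z + 2 * k * p.2 + p.1 * (1 - 2 * (z + 2 * k * p.2) + 2 * J (2 * m * p.2)))
    (p.1 * stripLevel (2 * m * p.2)))) ?_ ?_ ?_ ?_ ?_
  · have := continuous_stripLevel
    exact ι.continuous.comp ((continuous_tanglePoint c y).comp (by fun_prop :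
      Continuous fun p : ℝ × ℝ => (2 * m * p.2,
        z + 2 * k * p.2 + p.1 * (1 - 2 * (z + 2 * k * p.2) + 2 * J (2 * m * p.2)),
        p.1 * stripLevel (2 * m * p.2))))
  · intro u t
    have h2 := stripLevel_add_int (2 * m * t) (2 * m)
    push_cast at h2
    dsimp only
    rw [← tanglePoint_add c y (2 * m * t) _ _ m k, ← h2, hJper]
    congr 2 <;> ring_nf
  · intro t; rw [hγ, zero_mul, zero_mul, add_zero]
  · intro t
    simp only [raisedLoop_coe, one_mul]
    congr 1
    rcases le_total |2 * m * t - round (2 * m * t)| (1 / 4) with h | h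
    · rw [hJn _ _ h]
      have := tanglePoint_add c y (2 * m * t) (1 - z + 2 * (-k : ℤ) * t) (stripLevel (2 * m * t)) 0
        ⌊z + k * round (2 * m * t) / m⌋
      rw [← this]
      congr 1 <;> push_cast <;> ring
    · exact tanglePoint_inner _ _ _ _ _ (one_le_stripLevel h)
  · intro u t h0 h1 hmem
    obtain ⟨⟨n, hn⟩, hj⟩ := of_tanglePoint_mem_strands hy (hl _ hmem)
    dsimp only at hn hj
    rw [hn, stripLevel_int, mul_zero, hJn n n (by simp)] at hj
    obtain ⟨j, hj⟩ := hj zero_lt_one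
    have hw : z + k * n / m = z + 2 * k * t := by rw [← hn]; field_simp
    have hne := hz t n ⌊z + k * n / m⌋ hn
    rw [hw] at hj hne
    generalize z + 2 * k * t = w at hj hne
    -- both ends of the segment lie strictly between the same two marked points
    have hw1 : (⌊w⌋ : ℝ) < w := lt_of_le_of_ne (Int.floor_le w) hne.symm
    have hw2 : w < ⌊w⌋ + 1 := Int.lt_floor_add_one w
    have hj1 : (⌊w⌋ : ℝ) < j := by
      rcases h1.lt_or_eq with h1 | rfl
      · linarith [mul_pos (sub_pos.2 h1) (sub_pos.2 hw1), mul_nonneg h0 (sub_pos.2 hw2).le]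
      · linarith
    have hj2 : (j : ℝ) < ⌊w⌋ + 1 := by
      rcases h1.lt_or_eq with h1 | rfl
      · linarith [mul_pos (sub_pos.2 h1) (sub_pos.2 hw2), mul_nonneg h0 (sub_pos.2 hw1).le]
      · linarith
    have hj1' : ⌊w⌋ < j := by exact_mod_cast hj1
    have hj2' : j < ⌊w⌋ + 1 := by exact_mod_cast hj2
    omega

/-! ### Invariance of the loops under the group -/

/-- The loop of slope `s` and its image under a reflection in a Farey edge at `c` are homotopic in
the complement of the strands of the tangle of slope `c`. -/
theorem AlphaHomotopic.of_isReflection {r c y : Slope} (ι : C(TangleBall c, LinkSphere r))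
    (hι : ∀ x, ι (bdry c x) = bridgeSphere r x) (hl : ∀ z, ι z ∈ link r → z ∈ strands c)
    (hy : IsFareyEdge c y) {g : GL (Fin 2) ℚ} (hg : IsReflection g c y) (s : Slope) :
    AlphaHomotopic r s (g • s) := by
  obtain ⟨k, m, hs⟩ := exists_comb hy s
  have hgs := hg.slopeVec_smul hy hs
  by_cases hm : m = 0
  · -- here `s = c`, which the reflection fixes
    have : g • s = s := by
      rcases hgs with h | h
      · apply slopeVec_injective; rw [h, hs, hm]; simp
      · apply eq_of_slopeVec_eq_neg; rw [h, hs, hm]; ext <;> simp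
    rw [this]
    exact (alphaSetoid r).refl s
  · have hmr : (m : ℝ) ≠ 0 := by exact_mod_cast hm
    -- this height makes both lines miss the lattice
    set z : ℝ := 1 / (2 * m) with hz
    have hmz : 2 * (m * z) = 1 := by rw [hz]; field_simp
    have hav : ∀ (t : ℝ) (n j : ℤ), m * t = n → z + k * t ≠ j := by
      intro t n j hn hj
      have h : ((2 * (m * j - k * n) : ℤ) : ℝ) = (1 : ℤ) := by
        push_cast; rw [← hj, ← hn]; linear_combination hmz
      have h' : 2 * (m * j - k * n) = 1 := by exact_mod_cast h
      omega
    have hav' : ∀ (t : ℝ) (n j : ℤ), m * t = n → (1 - z) + (-k : ℤ) * t ≠ j := by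
      intro t n j hn hj
      refine hav t n (1 - j) hn ?_
      push_cast at hj ⊢
      linarith
    have hd := dir_eq_of_comb hs
    have hpt : ∀ x w, bridgeSphere r (proj (x • dir y + w • dir c)) = ι (tanglePoint c y x w 0) :=
      fun x w => by rw [tanglePoint_zero, hι]
    have hb : LineAvoidsLattice s (z • dir c) := by
      intro t ht
      rw [hd, show z • dir c + t • ((m : ℝ) • dir y + (k : ℝ) • dir c) =
        (m * t) • dir y + (z + k * t) • dir c by module] at ht
      obtain ⟨⟨n, hn⟩, j, hj⟩ := hy.int_of_mem_lattice ht
      exact hav t n j hn hj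
    have h1 : FreelyHomotopicInComplement r ((bridgeSphere r).comp (slopeLoop s (z • dir c)))
        (raisedLoop ι y m (-k) (1 - z)) := by
      refine homotopic_raisedLoop_reflect hl hy hm
        (fun t n j hn hj => hav (2 * t) n j (by linarith) (by linarith)) fun t => ?_
      rw [ContinuousMap.comp_apply, slopeLoop_coe, ← hpt, hd]
      congr 2
      module
    obtain ⟨ε, hε, hgd⟩ : ∃ ε : ℝ, (ε = 1 ∨ ε = -1) ∧
        dir (g • s) = ε • ((m : ℝ) • dir y + ((-k : ℤ) : ℝ) • dir c) := by
      rcases hgs with h | h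
      · exact ⟨-1, Or.inr rfl, by rw [dir, h]; ext <;> simp [dir, latticePoint] <;> ring⟩
      · exact ⟨1, Or.inl rfl, by rw [dir, h]; ext <;> simp [dir, latticePoint] <;> ring⟩
    have hb' : LineAvoidsLattice (g • s) ((1 - z) • dir c) := by
      intro t ht
      rw [hgd, show (1 - z) • dir c + t • ε • ((m : ℝ) • dir y + ((-k : ℤ) : ℝ) • dir c) =
        (m * (t * ε)) • dir y + ((1 - z) + (-k : ℤ) * (t * ε)) • dir c by module] at ht
      obtain ⟨⟨n, hn⟩, j, hj⟩ := hy.int_of_mem_lattice ht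
      exact hav' _ n j hn hj
    have h2 : ∀ γ : C(UnitAddCircle, LinkSphere r),
        (∀ t : ℝ, γ (t : UnitAddCircle) = bridgeSphere r (proj ((1 - z) • dir c +
          (2 * t) • ((m : ℝ) • dir y + ((-k : ℤ) : ℝ) • dir c)))) →
        FreelyHomotopicInComplement r γ (raisedLoop ι y m (-k) (1 - z)) := by
      intro γ hγ
      refine homotopic_raisedLoop hl hy
        (fun t n j hn hj => hav' (2 * t) n j (by linarith) (by linarith)) fun t => ?_
      rw [hγ, ← hpt]
      congr 2
      module
    refine AlphaHomotopic.of_pair hb hb' ?_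
    rcases hε with rfl | rfl
    · refine Or.inl (ContinuousMap.HomotopicWith.trans h1
        (ContinuousMap.HomotopicWith.symm (h2 _ fun t => ?_)))
      rw [ContinuousMap.comp_apply, slopeLoop_coe, hgd, one_smul]
    · refine Or.inr (ContinuousMap.HomotopicWith.trans h1
        (ContinuousMap.HomotopicWith.symm (h2 _ fun t => ?_)))
      change bridgeSphere r (slopeLoop _ _ (-(t : UnitAddCircle))) = _
      rw [← AddCircle.coe_neg, slopeLoop_coe, hgd]
      congr 2
      module

theorem alphaHomotopic_smul {r : Slope} {g : GL (Fin 2) ℚ} (hg : g ∈ GamHat r) (s : Slope) :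
    AlphaHomotopic r (g • s) s := by
  suffices h : GamHat r ≤ classStabilizer (alphaSetoid r) from h hg s
  refine sup_le ((Subgroup.closure_le _).2 ?_) ((Subgroup.closure_le _).2 ?_)
  · rintro g ⟨y, hy, hg⟩ s
    refine (alphaSetoid r).symm (AlphaHomotopic.of_isReflection
      ⟨fun z => Quot.mk (GlueRel r) (Sum.inr z), continuous_quot_mk.comp continuous_inr⟩
      (fun x => (bridgeSphere_eq_inr r x).symm) (fun z hz => ?_) hy hg s)
    exact mem_link_iff.1 hz
  · rintro g ⟨y, hy, hg⟩ s
    refine (alphaSetoid r).symm (AlphaHomotopic.of_isReflection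
      ⟨fun z => Quot.mk (GlueRel r) (Sum.inl z), continuous_quot_mk.comp continuous_inl⟩
      (fun x => rfl) (fun z hz => ?_) hy hg s)
    exact mem_link_iff.1 hz

end TwoBridge

end

theorem lemma7p1 (r : ℚ) (_hr0 : 0 < r) (_hr1 : r < 1)
    (l : List ℕ) (n : ℕ) (_hl : ∀ m ∈ l, 1 ≤ m) (_hn : 2 ≤ n)
    (_hr : r = TwoBridge.contFrac (l ++ [n])) (s : TwoBridge.Slope) :
    (∃! s₀ : TwoBridge.Slope, s₀ ∈ TwoBridge.fundSet l n ∧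
      s ∈ MulAction.orbit (TwoBridge.GamHat (r : TwoBridge.Slope)) s₀) ∧
    ∀ s₀ : TwoBridge.Slope, s₀ ∈ TwoBridge.fundSet l n →
      s ∈ MulAction.orbit (TwoBridge.GamHat (r : TwoBridge.Slope)) s₀ →
      TwoBridge.AlphaHomotopic (r : TwoBridge.Slope) s s₀ := by
  refine ⟨TwoBridge.existsUnique_mem_fundSet _hr0 _hr1 _hl _hn _hr s, ?_⟩
  rintro s₀ - ⟨⟨g, hg⟩, rfl⟩
  exact TwoBridge.alphaHomotopic_smul hg s₀
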